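/- Let $j\in\{0,\tfrac12,1,\tfrac32,\dots\}$ and let $V^j$ be the spin-$j$ irreducible unitary representation of $\mathrm{SU}(2)$, of dimension $\mathrm d_j=2j+1$, with its standard orthonormal weight basis $|j,m\rangle$, $m=-j,\dots,j$; write $t^j(g)$ for the action of $g\in\mathrm{SU}(2)$. For $n\in\mathrm{SU}(2)$ put $|j,n\rangle=t^j(n)|j,j\rangle$ and $\overline{|j,n\rangle}=t^j(n)|j,-j\rangle$. With $\epsilon=\begin{pmatrix}0&1\\-1&0\end{pmatrix}$ one has $|j,n\epsilon\rangle=(-1)^{2j}\,\overline{|j,n\rangle}$. For integers $0\le k\le 2j$ let $C^{jjk}:V^j\otimes V^j\to V^k$ be the Clebsch–Gordan map, with matrix elements $C^{jjk}_{m_1m_2m}=\langle k,m|C^{jjk}(|j,m_1\rangle\otimes|j,m_2\rangle)$ the (real) Clebsch–Gordan coefficients in the normalization in which the $\theta$-symbol is one and with the phase for which $C^{jjk}_{j,-j,0}>0$, and let $\overline{C^{jjk}}:V^k\to V^j\otimes V^j$ be the map with the complex conjugate matrix elements, i.e. its adjoint. These maps are $\mathrm{SU}(2)$-intertwiners and satisfy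 $$C^{jjk}\,\overline{C^{jjk'}}=\frac{\delta_{kk'}}{\mathrm d_k}1_k,\qquad \sum_{k=0}^{2j}\mathrm d_k\,\overline{C^{jjk}}\,C^{jjk}=1_j\otimes 1_j .$$ Put $C^j_k=(C^{jjk}_{j,-j,0})^2$. Then: 1. For every $n\in\mathrm{SU}(2)$, $$|j,n\rangle\otimes\overline{|j,n\rangle}=\sum_{k=0}^{2j}\mathrm d_k\sqrt{C^j_k}\;\overline{C^{jjk}}\bigl(t^k(n)|k,0\rangle\bigr),\qquad C^j_k=\frac{(2j)!}{(2j-k)!}\,\frac{(2j)!}{(2j+k+1)!}.$$ 2. Let $\mathrm dn$ be the Haar measure on $\mathrm{SU}(2)$ of total mass one. The state $|j,n\rangle\otimes\overline{|j,n\rangle}$ depends only on the coset $n\,\mathrm U(1)$ of the diagonal subgroup, the integral below converges, and $$G_j:=\mathrm d_j^2\int \mathrm dn\;|j,n\rangle\otimes\overline{|j,n\rangle}\;\langle j,n|\otimes\overline{\langle j,n|}=\mathrm d_j^2\sum_{k=0}^{2j}\mathrm d_k\,C^j_k\;\overline{C^{jjk}}\circ C^{jjk}.$$ 3. The $k=0$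 term is the product of the Barrett–Crane intertwiner with its conjugate: let $$B_j=\int\mathrm dn\,|j,n\rangle\otimes|j,n\epsilon\rangle=\frac1{\mathrm d_j}\sum_m|j,m\rangle\otimes t^j(\epsilon)|j,m\rangle ,$$ which is an $\mathrm{SU}(2)$-invariant vector of $V^j\otimes V^j$ (the second equality being part of the claim). Then $\mathrm d_j^2\,\mathrm d_0\,C^j_0\,\overline{C^{jj0}}\circ C^{jj0}=\mathrm d_j^2\,B_jB_j^{\dagger}$. 4. The weights decrease strictly in $k$: $C^j_0=1/\mathrm d_j$, $C^j_k=\dfrac{\mathrm d_j-k}{\mathrm d_j+k}\,C^j_{k-1}$ for $1\le k\le 2j$, and $C^j_{k'}<C^j_k$ for $0\le k<k'\le 2j$. -/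

import Mathlib

open MeasureTheory
open scoped TensorProduct Nat

namespace SpinFoam

noncomputable section

/-! ### The group `SU(2)` and its normalized Haar measure -/

/-- The group `SU(2)`. -/
abbrev SU2 : Type := Matrix.specialUnitaryGroup (Fin 2) ℂ

instance : IsTopologicalGroup SU2 where
  continuous_inv :=
    Continuous.subtype_mk (continuous_star.comp continuous_subtype_val) _

instance : CompactSpace SU2 := by
  refine isCompact_iff_compactSpace.mp (?_ : IsCompact
    ((Matrix.specialUnitaryGroup (Fin 2) ℂ : Submonoid _) : Set (Matrix (Fin 2) (Fin 2) ℂ)))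
  have hcl : IsClosed ((Matrix.specialUnitaryGroup (Fin 2) ℂ : Submonoid _) :
      Set (Matrix (Fin 2) (Fin 2) ℂ)) := by
    have h : ((Matrix.specialUnitaryGroup (Fin 2) ℂ : Submonoid _) :
        Set (Matrix (Fin 2) (Fin 2) ℂ)) = {A | A * star A = 1} ∩ {A | A.det = 1} := by
      ext A
      simp only [SetLike.mem_coe, Matrix.mem_specialUnitaryGroup_iff,
        Matrix.mem_unitaryGroup_iff, Set.mem_inter_iff, Set.mem_ofPred_eq]
    rw [h]
    exact (isClosed_eq (continuous_id.mul continuous_star) continuous_const).inter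
      (isClosed_eq (Continuous.matrix_det continuous_id) continuous_const)
  have hK : IsCompact (Set.pi Set.univ fun _ : Fin 2 =>
      Set.pi Set.univ fun _ : Fin 2 => Metric.closedBall (0 : ℂ) 1) :=
    isCompact_univ_pi fun _ => isCompact_univ_pi fun _ => isCompact_closedBall _ _
  refine IsCompact.of_isClosed_subset hK hcl fun A hA => ?_
  intro i _ k _
  rw [Metric.mem_closedBall, dist_zero_right]
  exact entry_norm_bound_of_unitary (Matrix.specialUnitaryGroup_le_unitaryGroup hA) i k

instance : MeasurableSpace SU2 := borel SU2

instance : BorelSpace SU2 := ⟨rfl⟩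

/-- The Haar measure of `SU(2)` with total mass one. -/
def haarSU2 : Measure SU2 := Measure.haarMeasure ⊤

/-- The element `ε = !![0, 1; -1, 0]` of `SU(2)`. -/
def eps : SU2 :=
  ⟨!![0, 1; -1, 0], by
    rw [Matrix.mem_specialUnitaryGroup_iff, Matrix.mem_unitaryGroup_iff]
    constructor
    · ext i k
      fin_cases i <;> fin_cases k <;> simp [Matrix.mul_apply, Matrix.star_apply]
    · simp [Matrix.det_fin_two]⟩

/-! ### The irreducible representations

Spins are recorded by `N = 2j`, a natural number.  The weight `m ∈ {-j, …, j}` of a basis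
state `|j, m⟩` is recorded by the index `a = j + m ∈ {0, …, N}`. -/

/-- The representation space `V^j` of dimension `d_j = 2j + 1 = N + 1`. -/
abbrev V (N : ℕ) : Type := EuclideanSpace ℂ (Fin (N + 1))

/-- The orthonormal basis state `|j, m⟩` with `a = j + m`. -/
def ket (N : ℕ) (a : Fin (N + 1)) : V N := EuclideanSpace.single a 1

/-- The highest weight state `|j, j⟩`. -/
def ketTop (N : ℕ) : V N := ket N (Fin.last N)

/-- The lowest weight state `|j, -j⟩`. -/
def ketBot (N : ℕ) : V N := ket N 0

/-- The weight zero index of the representation of integer spin `k = K`. -/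
def midIdx (K : ℕ) : Fin (2 * K + 1) := ⟨K, by omega⟩

/-- The spherical state `|k, 0⟩` of the representation of integer spin `k = K`. -/
def ketZero (K : ℕ) : V (2 * K) := ket (2 * K) (midIdx K)

/-- The linear substitution of variables by which a `2 × 2` matrix `g` acts on polynomials:
`x ↦ g₀₀ x + g₁₀ y`, `y ↦ g₀₁ x + g₁₁ y`. -/
def subst (g : Matrix (Fin 2) (Fin 2) ℂ) :
    MvPolynomial (Fin 2) ℂ →ₐ[ℂ] MvPolynomial (Fin 2) ℂ :=
  MvPolynomial.aeval fun i => ∑ l, MvPolynomial.C (g l i) * MvPolynomial.X l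

/-- The exponent of the monomial `x ^ a * y ^ (N - a)`. -/
def expo (N : ℕ) (a : Fin (N + 1)) : Fin 2 →₀ ℕ :=
  Finsupp.single 0 (a : ℕ) + Finsupp.single 1 (N - (a : ℕ))

/-- The matrix elements `t^j_{m m'}(g) = ⟨j, m| g |j, m'⟩`, in the realization of `V^j` by
homogeneous polynomials of degree `2j = N` in two variables, where `|j, m⟩` is the normalized
monomial `x ^ (j + m) * y ^ (j - m) / √((j + m)! (j - m)!)`. -/
def wigner (N : ℕ) (g : Matrix (Fin 2) (Fin 2) ℂ) :
    Matrix (Fin (N + 1)) (Fin (N + 1)) ℂ :=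
  Matrix.of fun a b =>
    (√((a : ℕ)! * (N - (a : ℕ))! : ℝ) : ℂ) / (√((b : ℕ)! * (N - (b : ℕ))! : ℝ) : ℂ) *
      MvPolynomial.coeff (expo N a) (subst g (MvPolynomial.monomial (expo N b) 1))

theorem subst_mul (g h : Matrix (Fin 2) (Fin 2) ℂ) :
    subst (g * h) = (subst g).comp (subst h) := by
  apply MvPolynomial.algHom_ext
  intro i
  simp only [subst, AlgHom.comp_apply, MvPolynomial.aeval_X, map_mul,
    MvPolynomial.aeval_C, MvPolynomial.algebraMap_eq, Matrix.mul_apply, Fin.sum_univ_two, map_add]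
  ring

theorem subst_one : subst 1 = AlgHom.id ℂ _ := by
  apply MvPolynomial.algHom_ext
  intro i
  fin_cases i <;> simp [subst, Fin.sum_univ_two]

theorem expo_injective (N : ℕ) : Function.Injective (expo N) := by
  intro a b h
  have := DFunLike.congr_fun h 0
  simp [expo] at this
  exact Fin.ext this

theorem degree_expo (N : ℕ) (a : Fin (N + 1)) : (expo N a).degree = N := by
  have := a.is_lt
  simp [expo, Finsupp.degree_eq_sum, Fin.sum_univ_two]
  omega

theorem subst_homogeneous (N : ℕ) (g : Matrix (Fin 2) (Fin 2) ℂ) (b : Fin (N + 1)) :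
    (subst g (MvPolynomial.monomial (expo N b) 1)).IsHomogeneous N := by
  have h1 : (MvPolynomial.monomial (expo N b) (1 : ℂ)).IsHomogeneous N :=
    MvPolynomial.isHomogeneous_monomial _ (degree_expo N b)
  have h2 := h1.aeval (fun i => ∑ l, MvPolynomial.C (g l i) * MvPolynomial.X l)
    (n := 1) (fun i => by
      apply MvPolynomial.IsHomogeneous.sum
      intro l _
      simpa using (MvPolynomial.isHomogeneous_C (Fin 2) (g l i)).mul
        (MvPolynomial.isHomogeneous_X ℂ l))
  simpa [subst] using h2

theorem eq_sum_of_homogeneous (N : ℕ) (P : MvPolynomial (Fin 2) ℂ) (hP : P.IsHomogeneous N) :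
    P = ∑ c : Fin (N + 1),
      MvPolynomial.coeff (expo N c) P • MvPolynomial.monomial (expo N c) (1 : ℂ) := by
  ext d
  simp only [MvPolynomial.coeff_sum, MvPolynomial.coeff_smul, MvPolynomial.coeff_monomial,
    smul_eq_mul, mul_ite, mul_one, mul_zero]
  by_cases hd : d.degree = N
  · have hsum : d 0 + d 1 = N := by
      simpa [Finsupp.degree_eq_sum, Fin.sum_univ_two] using hd
    have hde : expo N ⟨d 0, by omega⟩ = d := by
      ext i
      fin_cases i
      · simp [expo]
      · simp [expo]
        omega
    rw [Finset.sum_eq_single ⟨d 0, by omega⟩]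
    · rw [if_pos hde, hde]
    · intro c _ hc
      rw [if_neg]
      intro h
      exact hc (expo_injective N (h.trans hde.symm))
    · simp
  · rw [hP.coeff_eq_zero hd, Finset.sum_eq_zero]
    intro c _
    rw [if_neg]
    rintro rfl
    exact hd (degree_expo N c)

theorem wigner_one (N : ℕ) : wigner N 1 = 1 := by
  ext a b
  have hb : (√((b : ℕ)! * (N - (b : ℕ))! : ℝ) : ℂ) ≠ 0 := by
    rw [Complex.ofReal_ne_zero]
    positivity
  by_cases h : a = b
  · subst h
    simp only [wigner, subst_one, Matrix.of_apply, AlgHom.id_apply, MvPolynomial.coeff_monomial,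
      if_true, Matrix.one_apply_eq, mul_one]
    exact div_self hb
  · have h' : expo N b ≠ expo N a := fun e => h (expo_injective N e).symm
    simp [wigner, subst_one, MvPolynomial.coeff_monomial, h', h]

theorem wigner_mul (N : ℕ) (g h : Matrix (Fin 2) (Fin 2) ℂ) :
    wigner N (g * h) = wigner N g * wigner N h := by
  ext a b
  have key : MvPolynomial.coeff (expo N a) (subst (g * h) (MvPolynomial.monomial (expo N b) 1)) =
      ∑ c : Fin (N + 1),
        MvPolynomial.coeff (expo N c) (subst h (MvPolynomial.monomial (expo N b) 1)) *
        MvPolynomial.coeff (expo N a) (subst g (MvPolynomial.monomial (expo N c) 1)) := by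
    rw [subst_mul, AlgHom.comp_apply]
    conv_lhs => rw [eq_sum_of_homogeneous N _ (subst_homogeneous N h b)]
    simp only [map_sum, map_smul, MvPolynomial.coeff_sum, MvPolynomial.coeff_smul, smul_eq_mul]
  simp only [wigner, Matrix.of_apply, Matrix.mul_apply]
  rw [key, Finset.mul_sum]
  refine Finset.sum_congr rfl fun c _ => ?_
  have hc : (√((c : ℕ)! * (N - (c : ℕ))! : ℝ) : ℂ) ≠ 0 := by
    rw [Complex.ofReal_ne_zero]
    positivity
  have hb : (√((b : ℕ)! * (N - (b : ℕ))! : ℝ) : ℂ) ≠ 0 := by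
    rw [Complex.ofReal_ne_zero]
    positivity
  field_simp

/-- The spin `j = N / 2` representation `t^j` of `SU(2)` on `V^j`. -/
def rep (N : ℕ) : Representation ℂ SU2 (V N) where
  toFun g := Matrix.toEuclideanLin (wigner N g.1)
  map_one' := by
    ext v i
    simp [wigner_one]
  map_mul' g h := by
    ext v i
    simp [wigner_mul, Matrix.toLpLin_apply]

/-! ### Coherent states -/

/-- The coherent state `|j, n⟩ = n |j, j⟩`. -/
def coherent (N : ℕ) (n : SU2) : V N := rep N n (ketTop N)

/-- The conjugate coherent state `n |j, -j⟩`. -/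
def conjCoherent (N : ℕ) (n : SU2) : V N := rep N n (ketBot N)

/-- The state `|j, n⟩` tensored with the conjugate coherent state. -/
def gravState (N : ℕ) (n : SU2) : V N ⊗[ℂ] V N := coherent N n ⊗ₜ[ℂ] conjCoherent N n

/-! ### Clebsch-Gordan maps -/

/-- The Clebsch-Gordan coefficient `C^{jjk}_{m₁ m₂ m}` for `2j = N`, `k = K`, `a = j + m₁`,
`b = j + m₂`, `c = k + m`, in the normalization in which the theta symbol is one.  It vanishes
unless `m = m₁ + m₂`.  This is the standard Racah - van der Waerden sum
`∑ r, (-1)^r / (r! (2j-k-r)! (j-m₁-r)! (j+m₂-r)! (k-j+m₁+r)! (k-j-m₂+r)!)`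
over all `r` for which the arguments of all factorials are nonnegative. -/
def cgCoeff (N K : ℕ) (a b : Fin (N + 1)) (c : Fin (2 * K + 1)) : ℝ :=
  if (a : ℕ) + b + K = c + N then
    √((N - K)! * K ! * K ! / (N + K + 1)! * ((a : ℕ)! * (N - (a : ℕ))!) *
        ((b : ℕ)! * (N - (b : ℕ))!) * ((c : ℕ)! * (2 * K - (c : ℕ))!)) *
      ∑ r ∈ Finset.range (N + 1) with
          r + K ≤ N ∧ r + a ≤ N ∧ r ≤ b ∧ N ≤ K + a + r ∧ (b : ℕ) ≤ K + r,
        (-1 : ℝ) ^ r / (r ! * (N - K - r)! * (N - (a : ℕ) - r)! * ((b : ℕ) - r)! *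
          (K + a + r - N)! * (K + r - b)!)
  else 0

/-- The product basis `|j, m₁⟩ ⊗ |j, m₂⟩` of `V^j ⊗ V^j`. -/
def prodBasis (N : ℕ) : Module.Basis (Fin (N + 1) × Fin (N + 1)) ℂ (V N ⊗[ℂ] V N) :=
  (EuclideanSpace.basisFun (Fin (N + 1)) ℂ).toBasis.tensorProduct
    (EuclideanSpace.basisFun (Fin (N + 1)) ℂ).toBasis

/-- The map `C^{jjk} : V^j ⊗ V^j → V^k` with
`⟨k, m| C^{jjk} (|j, m₁⟩ ⊗ |j, m₂⟩) = C^{jjk}_{m₁ m₂ m}`. -/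
def cg (N K : ℕ) : V N ⊗[ℂ] V N →ₗ[ℂ] V (2 * K) :=
  (prodBasis N).constr ℂ fun p => ∑ c, (cgCoeff N K p.1 p.2 c : ℂ) • ket (2 * K) c

/-- The conjugate map `V^k → V^j ⊗ V^j`, with matrix elements
`(⟨j, m₁| ⊗ ⟨j, m₂|) (cgBar |k, m⟩)` the complex conjugates of `C^{jjk}_{m₁ m₂ m}`. -/
def cgBar (N K : ℕ) : V (2 * K) →ₗ[ℂ] V N ⊗[ℂ] V N :=
  (EuclideanSpace.basisFun (Fin (2 * K + 1)) ℂ).toBasis.constr ℂ fun c =>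
    ∑ a, ∑ b, (starRingEnd ℂ) (cgCoeff N K a b c : ℂ) • (ket N a ⊗ₜ[ℂ] ket N b)

/-- The weight `C^j_k = (C^{jjk}_{j, -j, 0})²`. -/
def weight (N K : ℕ) : ℝ := cgCoeff N K (Fin.last N) 0 (midIdx K) ^ 2

/-! ### The intertwiners -/

/-- The rank one operator `|ψ⟩⟨ψ|` on `V^j ⊗ V^j`, applied to a vector. -/
def ketBra (N : ℕ) (ψ x : V N ⊗[ℂ] V N) : V N ⊗[ℂ] V N := inner ℂ ψ x • ψ

/-- The gravitational intertwiner
`G_j = d_j² ∫ dn (|j, n⟩ ⊗ conj |j, n⟩) (⟨j, n| ⊗ conj ⟨j, n|)`, an operator on `V^j ⊗ V^j`,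
given by its action on vectors. -/
def gravIntertwiner (N : ℕ) (x : V N ⊗[ℂ] V N) : V N ⊗[ℂ] V N :=
  ((N : ℂ) + 1) ^ 2 • ∫ n, ketBra N (gravState N n) x ∂haarSU2

/-- The Barrett-Crane intertwiner `(1 / d_j) ∑ m, |j, m⟩ ⊗ ε |j, m⟩`, an `SU(2)`-invariant
vector of `V^j ⊗ V^j` (equivalently a map from the trivial representation). -/
def barrettCrane (N : ℕ) : V N ⊗[ℂ] V N :=
  ((N : ℂ) + 1)⁻¹ • ∑ a, ket N a ⊗ₜ[ℂ] rep N eps (ket N a)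

end

end SpinFoam

open SpinFoam

/-!
Everything is read off from the states `spinorState N u`, which represent the polynomials
`(u₀ x + u₁ y) ^ N / N!`. They span `V N`, a matrix `g` sends `spinorState N u` to
`spinorState N (g u)`, and the bilinear pairing of two of them is `(w ⬝ u) ^ N / N!`; this last
formula gives unitarity of the representations (`adjoint_rep`).

Contracting the Clebsch–Gordan coefficients with three such states turns Racah's sum into the
product of the binomial expansions of `(u₀ v₁ - u₁ v₀) ^ (2j - k)`, `(w ⬝ u) ^ k` and `(w ⬝ v) ^ k`
(`cg_spinorState_pairing`). This function of `u, v, w` is visibly invariant, so `cg` is an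
intertwiner, and so is its adjoint `cgBar`.

Schur's lemma needs no irreducibility theory here: an intertwiner is determined by its value on
the highest weight state, whose orbit spans, and that value has the same weight (`schur_ne`,
`schur_self`). Hence `cg N K ∘ cgBar N K'` vanishes for `K ≠ K'` and is a scalar for `K = K'`. The
scalar is found at the highest weight, where Racah's sum has a single term and the sum of squares
is an instance of the Vandermonde-type identity `sum_antidiagonal_choose_mul_choose`. The
resolution of the identity follows because `∑ k, (2k + 1) = (2j + 1)²`.

Applying the resolution of the identity to `|j, j⟩ ⊗ |j, -j⟩`, and then the group, decomposes
`gravState`. The integral for `G_j` becomes a double sum of the averages `haarAverage`, which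
intertwine by invariance of the Haar measure, so Schur's lemma and a trace evaluate them
(`haarAverage_eq_zero`, `haarAverage_self`). For the Barrett–Crane vector, both its sum over weights
and its integral are multiples of `cgBar N 0` of the spin zero state, since only the trivial
representation survives averaging.
-/

namespace SpinFoam

noncomputable section

open Matrix (mulVec)

/-! ### Homogeneous vectors and the matrix elements -/

/-- The vector of `V^j` which represents the polynomial `(u₀ x + u₁ y) ^ N / N!`, that is, the
unnormalized coherent state of the spinor `u`. -/
def spinorState (N : ℕ) (u : Fin 2 → ℂ) : V N :=
  WithLp.toLp 2 fun a => u 0 ^ (a : ℕ) * u 1 ^ (N - (a : ℕ)) /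
    (√((a : ℕ)! * (N - (a : ℕ))! : ℝ) : ℂ)

theorem toEuclideanLin_apply_eq_sum {m n : ℕ} (A : Matrix (Fin m) (Fin n) ℂ)
    (x : EuclideanSpace ℂ (Fin n)) (i : Fin m) :
    Matrix.toEuclideanLin A x i = ∑ k, A i k * x k := rfl

theorem ket_apply (N : ℕ) (a b : Fin (N + 1)) : ket N a b = if b = a then 1 else 0 := by
  rw [ket, PiLp.single_apply]

theorem sqrt_factorial_ne_zero (m n : ℕ) : (√(m ! * n ! : ℝ) : ℂ) ≠ 0 := by
  rw [Complex.ofReal_ne_zero]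
  positivity

theorem sqrt_factorial_mul_self (m n : ℕ) :
    (√(m ! * n ! : ℝ) : ℂ) * (√(m ! * n ! : ℝ) : ℂ) = m ! * n ! := by
  rw [← Complex.ofReal_mul, Real.mul_self_sqrt (by positivity)]
  push_cast
  rfl

theorem monomial_expo (N : ℕ) (b : Fin (N + 1)) :
    MvPolynomial.monomial (expo N b) (1 : ℂ) =
      MvPolynomial.X 0 ^ (b : ℕ) * MvPolynomial.X 1 ^ (N - (b : ℕ)) := by
  rw [MvPolynomial.X_pow_eq_monomial, MvPolynomial.X_pow_eq_monomial,
    MvPolynomial.monomial_mul, one_mul, expo]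

theorem linearForm_pow (N : ℕ) (p q : ℂ) :
    (MvPolynomial.C p * MvPolynomial.X 0 + MvPolynomial.C q * MvPolynomial.X 1 :
        MvPolynomial (Fin 2) ℂ) ^ N =
      ∑ b : Fin (N + 1), ((N ! : ℂ) * (p ^ (b : ℕ) * q ^ (N - (b : ℕ)) /
        ((b : ℕ)! * (N - (b : ℕ))!))) • MvPolynomial.monomial (expo N b) (1 : ℂ) := by
  rw [add_pow, Finset.sum_range]
  refine Finset.sum_congr rfl fun b _ => ?_
  have hb : (b : ℕ) ≤ N := Nat.lt_succ_iff.mp b.is_lt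
  rw [monomial_expo, mul_pow, mul_pow, ← map_pow, ← map_pow, MvPolynomial.smul_eq_C_mul]
  have hc : ((N.choose b : ℕ) : MvPolynomial (Fin 2) ℂ) =
      MvPolynomial.C ((N ! : ℂ) / ((b : ℕ)! * (N - (b : ℕ))!)) := by
    rw [← Nat.cast_choose ℂ hb]
    simp
  rw [hc]
  simp only [map_mul, div_eq_mul_inv]
  ring

theorem coeff_linearForm_pow (N : ℕ) (p q : ℂ) (a : Fin (N + 1)) :
    MvPolynomial.coeff (expo N a)
      ((MvPolynomial.C p * MvPolynomial.X 0 + MvPolynomial.C q * MvPolynomial.X 1 :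
        MvPolynomial (Fin 2) ℂ) ^ N) =
      (N ! : ℂ) * (p ^ (a : ℕ) * q ^ (N - (a : ℕ)) / ((a : ℕ)! * (N - (a : ℕ))!)) := by
  rw [linearForm_pow, MvPolynomial.coeff_sum, Finset.sum_eq_single a]
  · simp
  · intro b _ hb
    have : expo N b ≠ expo N a := fun h => hb (expo_injective N h)
    simp [MvPolynomial.coeff_monomial, this]
  · simp

theorem subst_linearForm (g : Matrix (Fin 2) (Fin 2) ℂ) (u : Fin 2 → ℂ) :
    subst g (MvPolynomial.C (u 0) * MvPolynomial.X 0 + MvPolynomial.C (u 1) * MvPolynomial.X 1) =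
      MvPolynomial.C (mulVec g u 0) * MvPolynomial.X 0 +
        MvPolynomial.C (mulVec g u 1) * MvPolynomial.X 1 := by
  simp only [subst, map_add, map_mul, MvPolynomial.aeval_X, MvPolynomial.aeval_C,
    MvPolynomial.algebraMap_eq, Fin.sum_univ_two, Matrix.mulVec, dotProduct]
  ring

/-- A matrix acts on the states `spinorState N u` through its action on the spinor `u`. -/
theorem toEuclideanLin_wigner_spinorState (N : ℕ) (g : Matrix (Fin 2) (Fin 2) ℂ)
    (u : Fin 2 → ℂ) :
    Matrix.toEuclideanLin (wigner N g) (spinorState N u) = spinorState N (mulVec g u) := by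
  ext a
  have ha := sqrt_factorial_ne_zero (a : ℕ) (N - (a : ℕ))
  have hN : (N ! : ℂ) ≠ 0 := Nat.cast_ne_zero.mpr N.factorial_ne_zero
  have key := coeff_linearForm_pow N (mulVec g u 0) (mulVec g u 1) a
  rw [← subst_linearForm, ← map_pow, linearForm_pow, map_sum, MvPolynomial.coeff_sum] at key
  simp only [map_smul, MvPolynomial.coeff_smul, smul_eq_mul, mul_assoc] at key
  rw [← Finset.mul_sum] at key
  have key' := mul_left_cancel₀ hN key
  rw [toEuclideanLin_apply_eq_sum]
  simp only [wigner, Matrix.of_apply, spinorState]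
  rw [← sqrt_factorial_mul_self (a : ℕ)] at key'
  rw [eq_div_iff ha]
  rw [eq_div_iff (mul_ne_zero ha ha)] at key'
  rw [← key', Finset.sum_mul, Finset.sum_mul]
  refine Finset.sum_congr rfl fun b _ => ?_
  have hb := sqrt_factorial_ne_zero (b : ℕ) (N - (b : ℕ))
  rw [← sqrt_factorial_mul_self (b : ℕ)]
  field_simp

theorem rep_spinorState (N : ℕ) (g : SU2) (u : Fin 2 → ℂ) :
    rep N g (spinorState N u) = spinorState N (mulVec g.1 u) :=
  toEuclideanLin_wigner_spinorState N g.1 u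

theorem rep_apply (N : ℕ) (g : SU2) (x : V N) (a : Fin (N + 1)) :
    rep N g x a = ∑ b, wigner N g.1 a b * x b := rfl

/-- The states of the spinors `(t, 1)` already separate points, since a polynomial in `t` with
infinitely many roots vanishes. -/
theorem eq_zero_of_sum_mul_spinorState {N : ℕ} {f : Fin (N + 1) → ℂ}
    (h : ∀ t : ℂ, ∑ a, f a * spinorState N ![t, 1] a = 0) : f = 0 := by
  have hp : (∑ a : Fin (N + 1), Polynomial.monomial (a : ℕ)
      (f a / (√((a : ℕ)! * (N - (a : ℕ))! : ℝ) : ℂ))) = 0 := by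
    apply Polynomial.funext
    intro t
    rw [Polynomial.eval_finsetSum, Polynomial.eval_zero, ← h t]
    refine Finset.sum_congr rfl fun a _ => ?_
    simp only [Polynomial.eval_monomial, spinorState, Matrix.cons_val_zero, Matrix.cons_val_one,
      one_pow]
    ring
  funext a
  have hc := congrArg (Polynomial.coeff · (a : ℕ)) hp
  simp only [Polynomial.finsetSum_coeff, Polynomial.coeff_monomial, Polynomial.coeff_zero,
    Fin.val_inj, Finset.sum_ite_eq', Finset.mem_univ, if_true] at hc
  exact (div_eq_zero_iff.mp hc).resolve_right (sqrt_factorial_ne_zero _ _)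

theorem eq_sum_ket {N : ℕ} (x : V N) : x = ∑ a, x a • ket N a := by
  ext b
  simp [ket_apply]

theorem basisFun_apply_eq_ket (N : ℕ) (a : Fin (N + 1)) :
    (EuclideanSpace.basisFun (Fin (N + 1)) ℂ).toBasis a = ket N a := by
  simp [ket]

theorem span_spinorState (N : ℕ) :
    Submodule.span ℂ (Set.range fun t : ℂ => spinorState N ![t, 1]) = ⊤ := by
  by_contra hne
  obtain ⟨f, hf0, hf⟩ := Submodule.exists_le_ker_of_lt_top _ (lt_top_iff_ne_top.mpr hne)
  have hz : (fun a => f (ket N a)) = 0 := by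
    refine eq_zero_of_sum_mul_spinorState (N := N) fun t => ?_
    have h1 : f (spinorState N ![t, 1]) = 0 := hf (Submodule.subset_span ⟨t, rfl⟩)
    rw [eq_sum_ket (spinorState N ![t, 1]), map_sum] at h1
    simpa [mul_comm] using h1
  apply hf0
  refine (EuclideanSpace.basisFun (Fin (N + 1)) ℂ).toBasis.ext fun a => ?_
  rw [basisFun_apply_eq_ket]
  simpa using congrFun hz a

theorem linearMap_ext_spinorState {N : ℕ} {W : Type*} [AddCommGroup W] [Module ℂ W]
    {f g : V N →ₗ[ℂ] W} (h : ∀ t : ℂ, f (spinorState N ![t, 1]) = g (spinorState N ![t, 1])) :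
    f = g :=
  LinearMap.ext_on_range (span_spinorState N) h

theorem tensor_ext_spinorState {N M : ℕ} {W : Type*} [AddCommGroup W] [Module ℂ W]
    {f g : V N ⊗[ℂ] V M →ₗ[ℂ] W}
    (h : ∀ u v : Fin 2 → ℂ, f (spinorState N u ⊗ₜ spinorState M v) =
      g (spinorState N u ⊗ₜ spinorState M v)) : f = g := by
  apply TensorProduct.ext
  refine linearMap_ext_spinorState fun s => ?_
  refine linearMap_ext_spinorState fun t => ?_
  exact h _ _

theorem ext_sum_spinorState_mul {N : ℕ} {x y : V N}
    (h : ∀ w : Fin 2 → ℂ, ∑ a, spinorState N w a * x a = ∑ a, spinorState N w a * y a) :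
    x = y := by
  have h0 : (fun a => x a - y a) = 0 := by
    refine eq_zero_of_sum_mul_spinorState fun t => ?_
    simp only [sub_mul, Finset.sum_sub_distrib, sub_eq_zero, mul_comm (x _), mul_comm (y _)]
    exact h _
  ext a
  exact sub_eq_zero.mp (congrFun h0 a)

theorem spinorState_pairing (N : ℕ) (w u : Fin 2 → ℂ) :
    ∑ a, spinorState N w a * spinorState N u a = (w 0 * u 0 + w 1 * u 1) ^ N / N ! := by
  rw [add_pow, Finset.sum_range, Finset.sum_div]
  refine Finset.sum_congr rfl fun a _ => ?_
  have hb : (a : ℕ) ≤ N := Nat.lt_succ_iff.mp a.is_lt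
  have hN : (N ! : ℂ) ≠ 0 := Nat.cast_ne_zero.mpr N.factorial_ne_zero
  have h1 : ((a : ℕ)! : ℂ) ≠ 0 := Nat.cast_ne_zero.mpr (Nat.factorial_ne_zero _)
  have h2 : ((N - (a : ℕ))! : ℂ) ≠ 0 := Nat.cast_ne_zero.mpr (Nat.factorial_ne_zero _)
  simp only [spinorState]
  rw [Nat.cast_choose ℂ hb, div_mul_div_comm, sqrt_factorial_mul_self, mul_pow, mul_pow]
  field_simp

/-- Paired with two spinor states, both sides give `(u ⬝ g w) ^ N / N!`. -/
theorem wigner_transpose (N : ℕ) (g : Matrix (Fin 2) (Fin 2) ℂ) :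
    wigner N g.transpose = (wigner N g).transpose := by
  apply Matrix.toEuclideanLin.injective
  refine linearMap_ext_spinorState fun t => ext_sum_spinorState_mul fun w => ?_
  rw [toEuclideanLin_wigner_spinorState, spinorState_pairing]
  set u : Fin 2 → ℂ := ![t, 1]
  have h := spinorState_pairing N u (mulVec g w)
  rw [← toEuclideanLin_wigner_spinorState] at h
  trans (u 0 * mulVec g w 0 + u 1 * mulVec g w 1) ^ N / (N ! : ℂ)
  · simp only [Matrix.mulVec, dotProduct, Fin.sum_univ_two, Matrix.transpose_apply]
    ring
  · rw [← h]
    simp only [toEuclideanLin_apply_eq_sum, Finset.mul_sum,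
      Matrix.transpose_apply]
    rw [Finset.sum_comm]
    exact Finset.sum_congr rfl fun a _ => Finset.sum_congr rfl fun b _ => by ring

theorem star_spinorState (N : ℕ) (u : Fin 2 → ℂ) (a : Fin (N + 1)) :
    star (spinorState N u a) = spinorState N (star u) a := by
  simp [spinorState]

theorem wigner_map_star (N : ℕ) (g : Matrix (Fin 2) (Fin 2) ℂ) :
    wigner N (g.map star) = (wigner N g).map star := by
  apply Matrix.toEuclideanLin.injective
  refine linearMap_ext_spinorState fun t => ?_
  rw [toEuclideanLin_wigner_spinorState]
  set u : Fin 2 → ℂ := ![t, 1]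
  have h1 : mulVec (g.map star) u = star (mulVec g (star u)) := by
    ext i
    fin_cases i <;> simp [Matrix.mulVec, dotProduct]
  ext a
  rw [h1, ← star_spinorState, ← toEuclideanLin_wigner_spinorState]
  simp only [toEuclideanLin_apply_eq_sum, Matrix.map_apply,
    star_sum, star_mul', star_spinorState, star_star]

theorem wigner_conjTranspose (N : ℕ) (g : Matrix (Fin 2) (Fin 2) ℂ) :
    wigner N g.conjTranspose = (wigner N g).conjTranspose := by
  rw [Matrix.conjTranspose, wigner_map_star, wigner_transpose, Matrix.conjTranspose]

/-- The representations are unitary. -/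
theorem adjoint_rep (N : ℕ) (g : SU2) : (rep N g).adjoint = rep N g⁻¹ := by
  change (Matrix.toEuclideanLin (wigner N g.1)).adjoint =
    Matrix.toEuclideanLin (wigner N g.1.conjTranspose)
  rw [wigner_conjTranspose, Matrix.toEuclideanLin_conjTranspose_eq_adjoint]

theorem inner_rep_right (N : ℕ) (g : SU2) (x y : V N) :
    inner ℂ x (rep N g y) = inner ℂ (rep N g⁻¹ x) y := by
  rw [← adjoint_rep, LinearMap.adjoint_inner_left]

theorem rep_inv_rep (N : ℕ) (g : SU2) (x : V N) : rep N g⁻¹ (rep N g x) = x := by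
  rw [← Module.End.mul_apply, ← map_mul, inv_mul_cancel, map_one, Module.End.one_apply]

theorem inner_rep_rep (N : ℕ) (g : SU2) (x y : V N) :
    inner ℂ (rep N g x) (rep N g y) = inner ℂ x y := by
  rw [inner_rep_right, rep_inv_rep]

theorem subst_monomial_expo (N : ℕ) (g : Matrix (Fin 2) (Fin 2) ℂ) (b : Fin (N + 1)) :
    subst g (MvPolynomial.monomial (expo N b) 1) =
      (MvPolynomial.C (g 0 0) * MvPolynomial.X 0 + MvPolynomial.C (g 1 0) * MvPolynomial.X 1) ^
          (b : ℕ) *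
        (MvPolynomial.C (g 0 1) * MvPolynomial.X 0 + MvPolynomial.C (g 1 1) * MvPolynomial.X 1) ^
          (N - (b : ℕ)) := by
  rw [monomial_expo, map_mul, map_pow, map_pow]
  simp [subst, Fin.sum_univ_two]

theorem rep_ket_of_subst (N : ℕ) (g : SU2) {a b : Fin (N + 1)} {z : ℂ}
    (hs : subst g.1 (MvPolynomial.monomial (expo N b) 1) =
      z • MvPolynomial.monomial (expo N a) 1)
    (hf : ((a : ℕ)! * (N - (a : ℕ))! : ℝ) = (b : ℕ)! * (N - (b : ℕ))!) :
    rep N g (ket N b) = z • ket N a := by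
  ext c
  rw [rep_apply]
  simp only [ket_apply, mul_ite, mul_one, mul_zero, Finset.sum_ite_eq', Finset.mem_univ, if_true,
    PiLp.smul_apply, smul_eq_mul, wigner, Matrix.of_apply, hs, MvPolynomial.coeff_smul,
    MvPolynomial.coeff_monomial]
  by_cases hca : c = a
  · rw [hca, if_pos rfl, if_pos rfl, hf, div_self (sqrt_factorial_ne_zero _ _), one_mul]
  · rw [if_neg fun e => hca (expo_injective N e).symm, if_neg hca]

theorem rep_ket_of_isDiag (N : ℕ) (h : SU2) (hh : (h : Matrix (Fin 2) (Fin 2) ℂ).IsDiag)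
    (b : Fin (N + 1)) :
    rep N h (ket N b) = (h.1 0 0 ^ (b : ℕ) * h.1 1 1 ^ (N - (b : ℕ))) • ket N b := by
  have h10 : h.1 1 0 = 0 := hh (by decide)
  have h01 : h.1 0 1 = 0 := hh (by decide)
  refine rep_ket_of_subst N h ?_ rfl
  rw [subst_monomial_expo, h10, h01, monomial_expo, MvPolynomial.smul_eq_C_mul]
  simp only [map_zero, zero_mul, add_zero, zero_add, mul_pow, map_mul, map_pow]
  ring

theorem rep_eps_ket (N : ℕ) (b : Fin (N + 1)) :
    rep N eps (ket N b) = (-1 : ℂ) ^ (b : ℕ) • ket N b.rev := by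
  have hrev : N - ((b.rev : Fin (N + 1)) : ℕ) = b := by
    rw [Fin.val_rev]
    omega
  have hrev' : ((b.rev : Fin (N + 1)) : ℕ) = N - b := by
    rw [Fin.val_rev]
    omega
  refine rep_ket_of_subst N eps ?_ (by rw [hrev, hrev', mul_comm])
  rw [subst_monomial_expo, monomial_expo, MvPolynomial.smul_eq_C_mul, hrev, hrev']
  simp [eps, neg_pow (MvPolynomial.X (R := ℂ) (1 : Fin 2))]
  ring

/-! ### Schur's lemma -/

theorem spinorState_smul (N : ℕ) (r : ℂ) (u : Fin 2 → ℂ) :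
    spinorState N (r • u) = r ^ N • spinorState N u := by
  ext a
  have ha : (a : ℕ) + (N - (a : ℕ)) = N := by omega
  have hr : r ^ N = r ^ (a : ℕ) * r ^ (N - (a : ℕ)) := by rw [← pow_add, ha]
  simp only [spinorState, Pi.smul_apply, PiLp.smul_apply, smul_eq_mul, mul_pow, hr]
  ring

theorem spinorState_one_zero (N : ℕ) :
    spinorState N ![1, 0] = (√(N ! * 0! : ℝ) : ℂ)⁻¹ • ketTop N := by
  ext a
  simp only [spinorState, ketTop, PiLp.smul_apply, smul_eq_mul, ket_apply, Matrix.cons_val_zero,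
    Matrix.cons_val_one, one_pow, one_mul]
  by_cases ha : a = Fin.last N
  · subst ha
    simp
  · have h1 : N - (a : ℕ) ≠ 0 := by
      have := Fin.val_lt_last ha
      omega
    rw [if_neg ha, zero_pow h1, zero_div, mul_zero]

/-- Up to a scalar, `SU(2)` carries the spinor `(1, 0)` to every spinor `(t, 1)`. -/
theorem exists_smul_mulVec_eq (t : ℂ) :
    ∃ (g : SU2) (r : ℂ), (![t, 1] : Fin 2 → ℂ) = r • Matrix.mulVec g.1 ![1, 0] := by
  have hpos : 0 < Complex.normSq t + 1 := by
    have := Complex.normSq_nonneg t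
    positivity
  set r : ℂ := (√(Complex.normSq t + 1) : ℂ) with hr
  have hr0 : r ≠ 0 := by
    rw [hr, Complex.ofReal_ne_zero]
    positivity
  have hrr : r * r = t * star t + 1 := by
    rw [hr, ← Complex.ofReal_mul, Real.mul_self_sqrt hpos.le]
    simp [Complex.mul_conj]
  have hsr : star r = r := Complex.conj_ofReal _
  refine ⟨⟨!![t / r, -1 / r; 1 / r, star t / r], ?_⟩, r, ?_⟩
  · rw [Matrix.mem_specialUnitaryGroup_iff, Matrix.mem_unitaryGroup_iff]
    constructor
    · ext i k
      fin_cases i <;> fin_cases k <;>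
        simp only [Matrix.mul_apply, Fin.sum_univ_two, Matrix.star_apply, Matrix.of_apply,
          Matrix.cons_val', Matrix.cons_val_zero, Matrix.cons_val_one, Matrix.cons_val_fin_one,
          star_div₀, star_neg, star_one, star_star, hsr, Fin.zero_eta, Fin.mk_one, Fin.isValue,
          Matrix.one_apply, if_true, zero_ne_one, one_ne_zero, if_false] <;>
        field_simp <;> first | ring1 | (rw [sq, hrr]; ring1) | rw [sq, hrr, add_comm]
    · rw [Matrix.det_fin_two_of]
      field_simp
      rw [sq, hrr]
      ring
  · ext i
    fin_cases i <;> simp [hr0, mul_div_cancel₀]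

/-- An intertwiner is determined by its value on the highest weight state: the group carries that
state, up to scalars, to the states of all spinors `(t, 1)`, and these span. -/
theorem intertwiner_eq_zero {N N' : ℕ} {T : V N →ₗ[ℂ] V N'}
    (hT : ∀ g x, T (rep N g x) = rep N' g (T x)) (h0 : T (ketTop N) = 0) : T = 0 := by
  refine linearMap_ext_spinorState fun t => ?_
  obtain ⟨g, r, h⟩ := exists_smul_mulVec_eq t
  rw [h, spinorState_smul, map_smul, ← rep_spinorState, hT, spinorState_one_zero, map_smul, h0]
  simp

/-- The diagonal element of `SU(2)` with entries `z` and `z⁻¹`. -/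
def diagSU2 (z : ℂ) (hz : ‖z‖ = 1) : SU2 :=
  ⟨Matrix.diagonal ![z, z⁻¹], by
    have hz0 : z ≠ 0 := norm_ne_zero_iff.mp (by rw [hz]; exact one_ne_zero)
    have hzs : z * star z = 1 := by
      have := Complex.mul_conj z
      rw [Complex.normSq_eq_norm_sq, hz] at this
      simpa using this
    rw [Matrix.mem_specialUnitaryGroup_iff, Matrix.mem_unitaryGroup_iff]
    constructor
    · rw [Matrix.star_eq_conjTranspose, Matrix.diagonal_conjTranspose, Matrix.diagonal_mul_diagonal,
        ← Matrix.diagonal_one]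
      congr 1
      ext i
      fin_cases i
      · simpa using hzs
      · have : z⁻¹ * (star z)⁻¹ = 1 := by rw [← mul_inv, hzs, inv_one]
        simpa using this
    · simp [Matrix.det_diagonal, Fin.prod_univ_two, hz0]⟩

theorem rep_diagSU2_ket (N : ℕ) (z : ℂ) (hz : ‖z‖ = 1) (b : Fin (N + 1)) :
    rep N (diagSU2 z hz) (ket N b) = (z ^ (b : ℕ) * z⁻¹ ^ (N - (b : ℕ))) • ket N b := by
  rw [rep_ket_of_isDiag N _ (Matrix.isDiag_diagonal _)]
  simp [diagSU2]

/-- An intertwiner to a space of no larger spin keeps the weight of the highest weight state, so a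
nonzero component forces `c = N`. The weights are separated by a single torus element, a root of
unity of order `2 * N + 1`. -/
theorem intertwiner_ketTop_apply {N N' : ℕ} (hN : N' ≤ N) {T : V N →ₗ[ℂ] V N'}
    (hT : ∀ g x, T (rep N g x) = rep N' g (T x)) {c : Fin (N' + 1)} (hc : T (ketTop N) c ≠ 0) :
    (c : ℕ) = N := by
  have hprim := Complex.isPrimitiveRoot_exp (2 * N + 1) (by omega)
  set z := Complex.exp (2 * Real.pi * Complex.I / ((2 * N + 1 : ℕ) : ℂ)) with hzdef
  have hz : ‖z‖ = 1 := hprim.norm'_eq_one (by omega)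
  have hz0 : z ≠ 0 := Complex.exp_ne_zero _
  have h := hT (diagSU2 z hz) (ketTop N)
  rw [ketTop, rep_diagSU2_ket, map_smul] at h
  conv_rhs at h => rw [eq_sum_ket (T (ket N (Fin.last N))), map_sum]
  simp only [map_smul, rep_diagSU2_ket] at h
  have hcomp := congrArg (fun v : V N' => v c) h
  simp only [PiLp.smul_apply, smul_eq_mul, WithLp.ofLp_sum, Finset.sum_apply, WithLp.ofLp_smul,
    Pi.smul_apply, ket_apply, mul_ite, mul_one, mul_zero, Finset.sum_ite_eq, Finset.mem_univ,
    if_true, Fin.val_last, Nat.sub_self, pow_zero] at hcomp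
  rw [mul_comm] at hcomp
  have hpow := mul_left_cancel₀ hc hcomp
  have hcN := c.is_lt
  have hpow' : z ^ (N + (N' - (c : ℕ))) = z ^ (c : ℕ) := by
    rw [pow_add, hpow, mul_assoc, ← mul_pow, inv_mul_cancel₀ hz0, one_pow, mul_one]
  have := hprim.pow_inj (by omega) (by omega) hpow'
  omega

theorem schur_of_lt {N N' : ℕ} (hN : N' < N) {T : V N →ₗ[ℂ] V N'}
    (hT : ∀ g x, T (rep N g x) = rep N' g (T x)) : T = 0 := by
  refine intertwiner_eq_zero hT ?_
  ext c
  by_contra hc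
  have h1 := intertwiner_ketTop_apply hN.le hT hc
  omega

theorem schur_ne {N N' : ℕ} (hN : N ≠ N') {T : V N →ₗ[ℂ] V N'}
    (hT : ∀ g x, T (rep N g x) = rep N' g (T x)) : T = 0 := by
  rcases lt_or_gt_of_ne hN with h | h
  · have hadj : T.adjoint = 0 := by
      refine schur_of_lt h fun g x => ?_
      refine ext_inner_right ℂ fun y => ?_
      rw [LinearMap.adjoint_inner_left, ← LinearMap.adjoint_inner_right (rep N' g), adjoint_rep,
        ← LinearMap.adjoint_inner_right (rep N g), adjoint_rep, LinearMap.adjoint_inner_left, hT]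
    rw [← LinearMap.adjoint_adjoint T, hadj, map_zero]
  · exact schur_of_lt h hT

theorem schur_self {N : ℕ} {T : V N →ₗ[ℂ] V N} (hT : ∀ g x, T (rep N g x) = rep N g (T x)) :
    T = (T (ketTop N) (Fin.last N)) • LinearMap.id := by
  rw [← sub_eq_zero]
  refine intertwiner_eq_zero (N := N) (N' := N) (fun g x => ?_) ?_
  · simp [hT, map_sub]
  · ext c
    by_cases hc : c = Fin.last N
    · subst hc
      simp [ketTop, ket_apply]
    · have h0 : T (ketTop N) c = 0 := by
        by_contra h
        exact hc (Fin.ext (intertwiner_ketTop_apply le_rfl hT h))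
      simp [ketTop, ket_apply, hc] at h0 ⊢
      exact h0

/-! ### Schur orthogonality for the Haar measure -/

instance : IsProbabilityMeasure haarSU2 :=
  ⟨by simpa [haarSU2] using
    Measure.haarMeasure_self (K₀ := (⊤ : TopologicalSpace.PositiveCompacts SU2))⟩

instance : haarSU2.IsMulLeftInvariant :=
  inferInstanceAs (Measure.haarMeasure ⊤).IsMulLeftInvariant

theorem continuous_rep (N : ℕ) (x : V N) : Continuous fun n : SU2 => rep N n x := by
  have hx : x ∈ Submodule.span ℂ (Set.range fun t : ℂ => spinorState N ![t, 1]) := by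
    rw [span_spinorState]
    trivial
  induction hx using Submodule.span_induction with
  | mem x h =>
    obtain ⟨t, rfl⟩ := h
    simp only [rep_spinorState]
    have hm : ∀ i, Continuous fun n : SU2 => Matrix.mulVec n.1 ![t, 1] i := fun i =>
      (continuous_apply i).comp (continuous_subtype_val.matrix_mulVec continuous_const)
    refine (PiLp.continuous_toLp 2 _).comp (continuous_pi fun a => ?_)
    exact (((hm 0).fun_pow _).fun_mul ((hm 1).fun_pow _)).div_const _
  | zero => simpa using continuous_const
  | add x y _ _ hx hy => simpa using hx.fun_add hy
  | smul c x _ hx => simpa using hx.fun_const_smul c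

theorem integrable_haarSU2_of_continuous {E : Type*} [NormedAddCommGroup E] {f : SU2 → E}
    (hf : Continuous f) : Integrable f haarSU2 :=
  hf.integrable_of_hasCompactSupport (HasCompactSupport.of_compactSpace f)

theorem continuous_inner_smul_rep {N N' : ℕ} (x₀ x : V N) (y₀ : V N') :
    Continuous fun n : SU2 => inner ℂ (rep N n x₀) x • rep N' n y₀ :=
  ((continuous_rep N x₀).inner continuous_const).fun_smul (continuous_rep N' y₀)

/-- The group average of the rank one operators `|n y₀⟩⟨n x₀|`. -/
def haarAverage {N N' : ℕ} (x₀ : V N) (y₀ : V N') : V N →ₗ[ℂ] V N' where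
  toFun x := ∫ n, inner ℂ (rep N n x₀) x • rep N' n y₀ ∂haarSU2
  map_add' x y := by
    rw [← integral_add (integrable_haarSU2_of_continuous (continuous_inner_smul_rep x₀ x y₀))
      (integrable_haarSU2_of_continuous (continuous_inner_smul_rep x₀ y y₀))]
    simp only [inner_add_right, add_smul]
  map_smul' c x := by
    rw [RingHom.id_apply, ← integral_smul]
    simp only [inner_smul_right, mul_smul]

theorem haarAverage_apply {N N' : ℕ} (x₀ x : V N) (y₀ : V N') :
    haarAverage x₀ y₀ x = ∫ n, inner ℂ (rep N n x₀) x • rep N' n y₀ ∂haarSU2 := rfl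

theorem haarAverage_rep {N N' : ℕ} (x₀ : V N) (y₀ : V N') (g : SU2) (x : V N) :
    haarAverage x₀ y₀ (rep N g x) = rep N' g (haarAverage x₀ y₀ x) := by
  have hcomm := (LinearMap.toContinuousLinearMap (rep N' g)).integral_comp_comm
    (integrable_haarSU2_of_continuous (continuous_inner_smul_rep x₀ x y₀))
  simp only [LinearMap.coe_toContinuousLinearMap'] at hcomm
  rw [haarAverage_apply, haarAverage_apply, ← hcomm, ← integral_mul_left_eq_self _ g]
  refine integral_congr_ae (Filter.Eventually.of_forall fun n => ?_)
  simp only [map_mul, Module.End.mul_apply, inner_rep_rep, map_smul]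

theorem haarAverage_eq_zero {N N' : ℕ} (hN : N ≠ N') (x₀ : V N) (y₀ : V N') :
    haarAverage x₀ y₀ = 0 :=
  schur_ne hN (haarAverage_rep x₀ y₀)

theorem haarAverage_self {N : ℕ} (x₀ y₀ : V N) :
    haarAverage x₀ y₀ = (inner ℂ x₀ y₀ / ((N : ℂ) + 1)) • LinearMap.id := by
  have hs := schur_self (haarAverage_rep x₀ y₀)
  set l := haarAverage x₀ y₀ (ketTop N) (Fin.last N)
  -- The scalar is found by taking traces.
  have htr : ∑ a, haarAverage x₀ y₀ (ket N a) a = inner ℂ x₀ y₀ := by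
    have h1 : ∀ a, haarAverage x₀ y₀ (ket N a) a =
        ∫ n, (inner ℂ (rep N n x₀) (ket N a) • rep N n y₀) a ∂haarSU2 := fun a =>
      ((EuclideanSpace.proj a : V N →L[ℂ] ℂ).integral_comp_comm (integrable_haarSU2_of_continuous
        (continuous_inner_smul_rep x₀ (ket N a) y₀))).symm
    simp only [h1]
    rw [← integral_finsetSum]
    · have h2 : ∀ n : SU2, ∑ a, (inner ℂ (rep N n x₀) (ket N a) • rep N n y₀) a =
          inner ℂ x₀ y₀ := by
        intro n
        rw [← inner_rep_rep N n x₀ y₀, PiLp.inner_apply]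
        refine Finset.sum_congr rfl fun a _ => ?_
        simp [ket, EuclideanSpace.inner_single_right, mul_comm]
      simp only [h2, integral_const, probReal_univ, one_smul]
    · intro a _
      exact integrable_haarSU2_of_continuous
        ((EuclideanSpace.proj a : V N →L[ℂ] ℂ).continuous.comp
          (continuous_inner_smul_rep x₀ (ket N a) y₀))
  rw [hs] at htr
  have hN : (N : ℂ) + 1 ≠ 0 := Nat.cast_add_one_ne_zero N
  have hl : ((N : ℂ) + 1) * l = inner ℂ x₀ y₀ := by
    rw [← htr]
    simp [ket_apply]
  rw [hs, ← hl, mul_div_cancel_left₀ _ hN]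

/-! ### Clebsch–Gordan maps in coordinates -/

theorem prodBasis_apply (N : ℕ) (p : Fin (N + 1) × Fin (N + 1)) :
    prodBasis N p = ket N p.1 ⊗ₜ[ℂ] ket N p.2 := by
  rw [prodBasis, Module.Basis.tensorProduct_apply', basisFun_apply_eq_ket, basisFun_apply_eq_ket]

theorem cg_ket_tmul_ket (N K : ℕ) (a b : Fin (N + 1)) :
    cg N K (ket N a ⊗ₜ ket N b) = ∑ c, (cgCoeff N K a b c : ℂ) • ket (2 * K) c := by
  rw [← prodBasis_apply N (a, b), cg, Module.Basis.constr_basis]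

theorem cg_ket_tmul_ket_apply (N K : ℕ) (a b : Fin (N + 1)) (c : Fin (2 * K + 1)) :
    cg N K (ket N a ⊗ₜ ket N b) c = cgCoeff N K a b c := by
  rw [cg_ket_tmul_ket]
  simp [ket_apply]

theorem cg_tmul_apply (N K : ℕ) (x y : V N) (c : Fin (2 * K + 1)) :
    cg N K (x ⊗ₜ y) c = ∑ a, ∑ b, (cgCoeff N K a b c : ℂ) * (x a * y b) := by
  conv_lhs => rw [eq_sum_ket x, eq_sum_ket y]
  simp only [TensorProduct.sum_tmul, TensorProduct.tmul_sum, TensorProduct.smul_tmul_smul,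
    map_sum, map_smul, WithLp.ofLp_sum, Finset.sum_apply, WithLp.ofLp_smul, Pi.smul_apply,
    cg_ket_tmul_ket_apply, smul_eq_mul]
  rw [Finset.sum_comm]
  exact Finset.sum_congr rfl fun a _ => Finset.sum_congr rfl fun b _ => mul_comm _ _

theorem cgBar_ket (N K : ℕ) (c : Fin (2 * K + 1)) :
    cgBar N K (ket (2 * K) c) = ∑ a, ∑ b, (cgCoeff N K a b c : ℂ) • (ket N a ⊗ₜ[ℂ] ket N b) := by
  rw [← basisFun_apply_eq_ket, cgBar, Module.Basis.constr_basis]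
  simp only [Complex.conj_ofReal]

theorem cg_cgBar_ket_apply (N K K' : ℕ) (c' : Fin (2 * K' + 1)) (c : Fin (2 * K + 1)) :
    cg N K (cgBar N K' (ket (2 * K') c')) c =
      ∑ a, ∑ b, (cgCoeff N K' a b c' : ℂ) * cgCoeff N K a b c := by
  simp [cgBar_ket, cg_ket_tmul_ket_apply]

theorem inner_ket (N : ℕ) (a : Fin (N + 1)) (x : V N) : inner ℂ (ket N a) x = x a := by
  rw [ket, EuclideanSpace.inner_single_left]
  simp

theorem cgBar_eq_adjoint (N K : ℕ) : cgBar N K = (cg N K).adjoint := by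
  rw [LinearMap.eq_adjoint_iff_basis (EuclideanSpace.basisFun (Fin (2 * K + 1)) ℂ).toBasis
    (prodBasis N)]
  rintro c ⟨a, b⟩
  rw [basisFun_apply_eq_ket, prodBasis_apply, inner_ket, cg_ket_tmul_ket_apply, cgBar_ket]
  simp only [sum_inner, TensorProduct.smul_tmul', TensorProduct.inner_tmul, inner_smul_left,
    inner_ket, ket_apply, Complex.conj_ofReal]
  simp

/-! ### Equivariance of the Clebsch–Gordan maps -/

/-- A summand of Racah's sum, multiplied by the matching monomial in three spinors, is a product of
one term from each of three binomial expansions. Here `r + r' = 2j - k`, `t' + t = k` and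
`s + s' = k` when `n = 2j - k`. -/
theorem racah_summand (r r' t t' s s' n k : ℕ) (u v w : Fin 2 → ℂ) :
    (-1 : ℂ) ^ r / (r ! * r' ! * t ! * s ! * t' ! * s' !) *
        ((u 0 ^ (t' + r') * u 1 ^ (r + t)) * (v 0 ^ (r + s) * v 1 ^ (r' + s')) *
          (w 0 ^ (t' + s) * w 1 ^ (t + s'))) * (n ! * k ! * k !) =
      ((-(u 1 * v 0)) ^ r * (u 0 * v 1) ^ r' * (n ! / (r ! * r' !) : ℂ)) *
        ((w 0 * u 0) ^ t' * (w 1 * u 1) ^ t * (k ! / (t' ! * t !) : ℂ)) *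
        ((w 0 * v 0) ^ s * (w 1 * v 1) ^ s' * (k ! / (s ! * s' !) : ℂ)) := by
  have h : ∀ m : ℕ, (m ! : ℂ) ≠ 0 := fun m => Nat.cast_ne_zero.mpr m.factorial_ne_zero
  have h1 := h r
  have h2 := h r'
  have h3 := h t
  have h4 := h t'
  have h5 := h s
  have h6 := h s'
  rw [neg_pow (u 1 * v 0)]
  field_simp
  ring

theorem cgCoeff_mul_spinorState (N K : ℕ) (u v w : Fin 2 → ℂ) (a b : Fin (N + 1))
    (c : Fin (2 * K + 1)) :
    spinorState (2 * K) w c *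
        ((cgCoeff N K a b c : ℂ) * (spinorState N u a * spinorState N v b)) =
      (√((N - K)! * K ! * K ! / (N + K + 1)! : ℝ) : ℂ) * ∑ r ∈ Finset.range (N + 1),
        if ((a : ℕ) + b + K = c + N) ∧
          (r + K ≤ N ∧ r + a ≤ N ∧ r ≤ b ∧ N ≤ K + a + r ∧ (b : ℕ) ≤ K + r) then
        (-1 : ℂ) ^ r / (r ! * (N - K - r)! * (N - (a : ℕ) - r)! * ((b : ℕ) - r)! *
          (K + a + r - N)! * (K + r - b)!) *
        ((u 0 ^ (a : ℕ) * u 1 ^ (N - (a : ℕ))) * (v 0 ^ (b : ℕ) * v 1 ^ (N - (b : ℕ))) *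
          (w 0 ^ (c : ℕ) * w 1 ^ (2 * K - (c : ℕ)))) else 0 := by
  by_cases hc : (a : ℕ) + b + K = c + N
  · have h1 := sqrt_factorial_ne_zero (a : ℕ) (N - (a : ℕ))
    have h2 := sqrt_factorial_ne_zero (b : ℕ) (N - (b : ℕ))
    have h3 := sqrt_factorial_ne_zero (c : ℕ) (2 * K - (c : ℕ))
    simp only [cgCoeff, hc, if_true, true_and, spinorState]
    rw [Real.sqrt_mul (x := _ * _ * _) (by positivity), Real.sqrt_mul (x := _ * _) (by positivity),
      Real.sqrt_mul (x := _ / _) (by positivity), ← Finset.sum_filter, ← Finset.sum_mul]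
    simp only [Complex.ofReal_mul, Complex.ofReal_sum]
    generalize (√((a : ℕ)! * (N - (a : ℕ))! : ℝ) : ℂ) = A at h1 ⊢
    generalize (√((b : ℕ)! * (N - (b : ℕ))! : ℝ) : ℂ) = B at h2 ⊢
    generalize (√((c : ℕ)! * (2 * K - (c : ℕ))! : ℝ) : ℂ) = C at h3 ⊢
    push_cast
    generalize (Finset.sum _ _ : ℂ) = S
    field_simp
  · simp [cgCoeff, hc]

/-- The generating function of the Clebsch–Gordan coefficients: contracted with three spinors they
give a product of powers of the elementary invariants. -/
theorem cg_spinorState_pairing {N K : ℕ} (hK : K ≤ N) (u v w : Fin 2 → ℂ) :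
    ∑ c, spinorState (2 * K) w c * cg N K (spinorState N u ⊗ₜ spinorState N v) c =
      (√((N - K)! * K ! * K ! / (N + K + 1)! : ℝ) : ℂ) / ((N - K)! * K ! * K !) *
        ((-(u 1 * v 0) + u 0 * v 1) ^ (N - K) * (w 0 * u 0 + w 1 * u 1) ^ K *
          (w 0 * v 0 + w 1 * v 1) ^ K) := by
  simp only [cg_tmul_apply, Finset.mul_sum, cgCoeff_mul_spinorState]
  simp only [← Finset.mul_sum]
  have hf : ((N - K)! * K ! * K ! : ℂ) ≠ 0 := by
    have h : ∀ m : ℕ, (m ! : ℂ) ≠ 0 := fun m => Nat.cast_ne_zero.mpr m.factorial_ne_zero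
    exact mul_ne_zero (mul_ne_zero (h _) (h _)) (h _)
  rw [div_mul_eq_mul_div, eq_div_iff hf]
  refine (mul_assoc _ _ _).trans ?_
  congr 1
  have hprod : ∀ G : Fin (2 * K + 1) → Fin (N + 1) → Fin (N + 1) → ℕ → ℂ,
      ∑ c, ∑ a, ∑ b, ∑ r ∈ Finset.range (N + 1), G c a b r =
        ∑ p ∈ Finset.univ ×ˢ Finset.univ ×ˢ Finset.univ ×ˢ Finset.range (N + 1),
          G p.1 p.2.1 p.2.2.1 p.2.2.2 := fun G => by simp only [Finset.sum_product]
  have hprod' : ∀ (A B C : ℕ → ℂ) (n k : ℕ),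
      (∑ r ∈ Finset.range n, A r) * (∑ t ∈ Finset.range k, B t) * (∑ s ∈ Finset.range k, C s) =
        ∑ p ∈ Finset.range n ×ˢ Finset.range k ×ˢ Finset.range k,
          A p.1 * B p.2.1 * C p.2.2 := by
    intro A B C n k
    rw [Finset.sum_product, mul_assoc, Finset.sum_mul]
    refine Finset.sum_congr rfl fun r _ => ?_
    rw [Finset.sum_product, Finset.sum_mul_sum, Finset.mul_sum]
    refine Finset.sum_congr rfl fun t _ => ?_
    rw [Finset.mul_sum]
    exact Finset.sum_congr rfl fun s _ => (mul_assoc _ _ _).symm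
  rw [hprod, ← Finset.sum_filter, Finset.sum_mul, add_pow, add_pow, add_pow, hprod']
  -- The exponents `t'` and `s` index the two powers of order `K`, and `a = t' + (N - K - r)`,
  -- `b = r + s`, `c = t' + s`.
  refine Finset.sum_bij' (fun p _ => (p.2.2.2, K + p.2.1 + p.2.2.2 - N, p.2.2.1 - p.2.2.2))
    (fun q hq => (⟨q.2.1 + q.2.2, ?_⟩, ⟨q.2.1 + (N - K - q.1), ?_⟩, ⟨q.1 + q.2.2, ?_⟩, q.1))
    ?_ ?_ ?_ ?_ ?_
  · simp only [Finset.mem_product, Finset.mem_range] at hq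
    omega
  · simp only [Finset.mem_product, Finset.mem_range] at hq
    omega
  · simp only [Finset.mem_product, Finset.mem_range] at hq
    omega
  · rintro ⟨c, a, b, r⟩ hp
    simp only [Finset.mem_filter, Finset.mem_product, Finset.mem_univ, true_and,
      Finset.mem_range] at hp ⊢
    omega
  · rintro ⟨r, t, s⟩ hq
    simp only [Finset.mem_filter, Finset.mem_product, Finset.mem_univ, true_and,
      Finset.mem_range] at hq ⊢
    omega
  · rintro ⟨c, a, b, r⟩ hp
    simp only [Finset.mem_filter, Finset.mem_product, Finset.mem_univ, true_and,
      Finset.mem_range] at hp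
    simp only [Prod.mk.injEq, Fin.ext_iff, and_true]
    refine ⟨?_, ?_, ?_⟩ <;> omega
  · rintro ⟨r, t, s⟩ hq
    simp only [Finset.mem_product, Finset.mem_range] at hq
    simp only [Prod.mk.injEq, true_and]
    refine ⟨?_, ?_⟩ <;> omega
  · rintro ⟨c, a, b, r⟩ hp
    simp only [Finset.mem_filter, Finset.mem_product, Finset.mem_univ, true_and,
      Finset.mem_range] at hp
    obtain ⟨hr, hc, h1, h2, h3, h4, h5⟩ := hp
    have key := racah_summand r (N - K - r) (N - a - r) (K + a + r - N) (b - r) (K + r - b)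
      (N - K) K u v w
    rw [show K + a + r - N + (N - K - r) = a by omega, show r + (N - a - r) = N - a by omega,
      show r + ((b : ℕ) - r) = b by omega, show N - K - r + (K + r - b) = N - b by omega,
      show K + a + r - N + (b - r) = (c : ℕ) by omega,
      show N - a - r + (K + r - b) = 2 * K - c by omega] at key
    simp only
    rw [key, Nat.cast_choose ℂ (show r ≤ N - K by omega),
      Nat.cast_choose ℂ (show K + a + r - N ≤ K by omega),
      Nat.cast_choose ℂ (show (b : ℕ) - r ≤ K by omega),
      show K - (K + a + r - N) = N - a - r by omega, show K - (b - r) = K + r - b by omega]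

/-- The group element moves to the other side of the pairing as its transpose. -/
theorem sum_spinorState_mul_rep (N : ℕ) (g : SU2) (w : Fin 2 → ℂ) (x : V N) :
    ∑ a, spinorState N w a * rep N g x a =
      ∑ a, spinorState N (Matrix.mulVec g.1.transpose w) a * x a := by
  rw [← toEuclideanLin_wigner_spinorState, wigner_transpose]
  simp only [rep_apply, toEuclideanLin_apply_eq_sum, Matrix.transpose_apply, Finset.mul_sum,
    Finset.sum_mul]
  rw [Finset.sum_comm]
  exact Finset.sum_congr rfl fun a _ => Finset.sum_congr rfl fun b _ => by ring

theorem cg_intertwines {N K : ℕ} (hK : K ≤ N) (g : SU2) :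
    cg N K ∘ₗ TensorProduct.map (rep N g) (rep N g) = rep (2 * K) g ∘ₗ cg N K := by
  refine tensor_ext_spinorState fun u v => ext_sum_spinorState_mul fun w => ?_
  rw [LinearMap.comp_apply, LinearMap.comp_apply, sum_spinorState_mul_rep,
    TensorProduct.map_tmul, rep_spinorState, rep_spinorState, cg_spinorState_pairing hK,
    cg_spinorState_pairing hK]
  have hdet : g.1 0 0 * g.1 1 1 - g.1 0 1 * g.1 1 0 = 1 := by
    rw [← Matrix.det_fin_two]
    exact (Matrix.mem_specialUnitaryGroup_iff.mp g.2).2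
  simp only [Matrix.mulVec, dotProduct, Fin.sum_univ_two, Matrix.transpose_apply]
  congr 3
  · congr 1
    linear_combination (u 0 * v 1 - u 1 * v 0) * hdet
  · ring
  · ring

theorem cgBar_intertwines {N K : ℕ} (hK : K ≤ N) (g : SU2) :
    TensorProduct.map (rep N g) (rep N g) ∘ₗ cgBar N K = cgBar N K ∘ₗ rep (2 * K) g := by
  have h := congrArg LinearMap.adjoint (cg_intertwines hK g⁻¹)
  rw [LinearMap.adjoint_comp, LinearMap.adjoint_comp, TensorProduct.adjoint_map, adjoint_rep,
    adjoint_rep, inv_inv, ← cgBar_eq_adjoint] at h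
  exact h

/-! ### Special values of the Clebsch–Gordan coefficients -/

theorem sum_antidiagonal_choose_mul_choose (K n : ℕ) :
    ∑ p ∈ Finset.HasAntidiagonal.antidiagonal n, ((K + p.1).choose K * (K + p.2).choose K : ℕ) =
      (2 * K + 1 + n).choose (2 * K + 1) := by
  have h : (PowerSeries.invOneSubPow ℤ (2 * K + 1 + 1)).val =
      (PowerSeries.invOneSubPow ℤ (K + 1)).val * (PowerSeries.invOneSubPow ℤ (K + 1)).val := by
    rw [← Units.val_mul, ← PowerSeries.invOneSubPow_add]
    congr 2
    ring
  have hc := congrArg (PowerSeries.coeff n) h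
  simp only [PowerSeries.invOneSubPow_val_succ_eq_mk_add_choose, PowerSeries.coeff_mul,
    PowerSeries.coeff_mk] at hc
  exact_mod_cast hc.symm

/-- The coefficient at the boundary of its domain, where Racah's sum has a single term. -/
theorem cgCoeff_eq_single {N K : ℕ} {a b : Fin (N + 1)} {c : Fin (2 * K + 1)} (r : ℕ)
    (hc : (a : ℕ) + b + K = c + N)
    (hr : ∀ s : ℕ, (s + K ≤ N ∧ s + a ≤ N ∧ s ≤ b ∧ N ≤ K + a + s ∧ (b : ℕ) ≤ K + s) ↔ s = r) :
    cgCoeff N K a b c =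
      √((N - K)! * K ! * K ! / (N + K + 1)! * ((a : ℕ)! * (N - (a : ℕ))!) *
        ((b : ℕ)! * (N - (b : ℕ))!) * ((c : ℕ)! * (2 * K - (c : ℕ))!)) *
      ((-1 : ℝ) ^ r / (r ! * (N - K - r)! * (N - (a : ℕ) - r)! * ((b : ℕ) - r)! *
          (K + a + r - N)! * (K + r - b)!)) := by
  have hfilter : (Finset.range (N + 1)).filter (fun s => s + K ≤ N ∧ s + (a : ℕ) ≤ N ∧ s ≤ b ∧
      N ≤ K + a + s ∧ (b : ℕ) ≤ K + s) = {r} := by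
    ext s
    simp only [Finset.mem_filter, hr, Finset.mem_singleton, Finset.mem_range]
    refine ⟨fun h => h.2, fun h => ⟨?_, h⟩⟩
    have := (hr s).mpr h
    omega
  rw [cgCoeff, if_pos hc, hfilter, Finset.sum_singleton]

theorem cgCoeff_last_sq (N K : ℕ) (a b : Fin (N + 1)) :
    cgCoeff N K a b (Fin.last (2 * K)) ^ 2 = if (a : ℕ) + b = N + K then
      ((N - K)! * (2 * K)! / (N + K + 1)! : ℝ) * (((a : ℕ).choose K * (b : ℕ).choose K : ℕ) : ℝ)
      else 0 := by
  have ha := a.is_lt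
  have hb := b.is_lt
  split_ifs with h
  · rw [cgCoeff_eq_single (N - a) (by rw [Fin.val_last]; omega) (by intro s; omega), mul_pow,
      Real.sq_sqrt (by positivity), div_pow, ← pow_mul, mul_comm _ 2, pow_mul, neg_one_sq, one_pow,
      Fin.val_last, show N - K - (N - (a : ℕ)) = a - K by omega,
      show N - (a : ℕ) - (N - a) = 0 by omega, show (b : ℕ) - (N - a) = K by omega,
      show K + (a : ℕ) + (N - a) - N = K by omega, show K + (N - (a : ℕ)) - b = 0 by omega,
      show 2 * K - 2 * K = 0 by omega, show N - (b : ℕ) = a - K by omega]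
    have hab : N - (a : ℕ) = b - K := by omega
    rw [Nat.cast_mul, Nat.cast_choose ℝ (show K ≤ (a : ℕ) by omega),
      Nat.cast_choose ℝ (show K ≤ (b : ℕ) by omega), hab]
    simp only [Nat.factorial_zero, Nat.cast_one, mul_one]
    field_simp
  · rw [cgCoeff, if_neg, zero_pow two_ne_zero]
    rw [Fin.val_last]
    omega

/-- The squared norm of `cgBar N K` of the highest weight state. -/
theorem sum_cgCoeff_last_sq {N K : ℕ} (hK : K ≤ N) :
    ∑ a, ∑ b, cgCoeff N K a b (Fin.last (2 * K)) ^ 2 = (2 * (K : ℝ) + 1)⁻¹ := by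
  simp only [cgCoeff_last_sq]
  rw [← Fintype.sum_prod_type' (f := fun a b : Fin (N + 1) => if (a : ℕ) + b = N + K then
      ((N - K)! * (2 * K)! / (N + K + 1)! : ℝ) * (((a : ℕ).choose K * (b : ℕ).choose K : ℕ) : ℝ)
      else 0), ← Finset.sum_filter, ← Finset.mul_sum, ← Nat.cast_sum]
  have h : ∑ p : Fin (N + 1) × Fin (N + 1) with (p.1 : ℕ) + p.2 = N + K,
      ((p.1 : ℕ).choose K * (p.2 : ℕ).choose K) = (N + K + 1).choose (2 * K + 1) := by
    rw [show N + K + 1 = 2 * K + 1 + (N - K) by omega, ← sum_antidiagonal_choose_mul_choose]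
    refine Finset.sum_bij' (fun p _ => ((p.1 : ℕ) - K, (p.2 : ℕ) - K))
      (fun q hq => (⟨K + q.1, ?_⟩, ⟨K + q.2, ?_⟩)) ?_ ?_ ?_ ?_ ?_
    · rw [Finset.HasAntidiagonal.mem_antidiagonal] at hq
      omega
    · rw [Finset.HasAntidiagonal.mem_antidiagonal] at hq
      omega
    · rintro ⟨a, b⟩ hp
      simp only [Finset.mem_filter, Finset.mem_univ, true_and,
        Finset.HasAntidiagonal.mem_antidiagonal] at hp ⊢
      omega
    · rintro ⟨i, k⟩ hq
      simp only [Finset.mem_filter, Finset.mem_univ, true_and,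
        Finset.HasAntidiagonal.mem_antidiagonal] at hq ⊢
      omega
    · rintro ⟨a, b⟩ hp
      simp only [Finset.mem_filter, Finset.mem_univ, true_and] at hp
      simp only [Prod.mk.injEq, Fin.ext_iff]
      omega
    · rintro ⟨i, k⟩ hq
      simp
    · rintro ⟨a, b⟩ hp
      simp only [Finset.mem_filter, Finset.mem_univ, true_and] at hp
      simp only
      rw [show K + ((a : ℕ) - K) = a by omega, show K + ((b : ℕ) - K) = b by omega]
  rw [h, Nat.cast_choose ℝ (by omega), show N + K + 1 - (2 * K + 1) = N - K by omega,
    Nat.factorial_succ (2 * K)]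
  push_cast
  field_simp

theorem cgCoeff_highest_lowest {N K : ℕ} (hK : K ≤ N) :
    cgCoeff N K (Fin.last N) 0 (midIdx K) =
      √(((N ! : ℝ) * N !) / ((N - K)! * (N + K + 1)!)) := by
  have hm : ((midIdx K : Fin (2 * K + 1)) : ℕ) = K := rfl
  rw [cgCoeff_eq_single 0 (by simp [hm]; omega) (by intro s; simp; omega), hm]
  simp only [Fin.val_last, Fin.val_zero, Nat.sub_self, Nat.sub_zero, Nat.factorial_zero, pow_zero,
    Nat.cast_one, one_mul, mul_one, add_zero, Nat.add_sub_cancel, show 2 * K - K = K by omega]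
  rw [show ((N - K)! * K ! * K ! / (N + K + 1)! * N ! * N ! * (K ! * K !) : ℝ) =
      ((N - K)! * K ! * K ! : ℝ) ^ 2 * (((N ! : ℝ) * N !) / ((N - K)! * (N + K + 1)!)) by
    field_simp, Real.sqrt_mul (by positivity), Real.sqrt_sq (by positivity)]
  field_simp

theorem weight_eq {N K : ℕ} (hK : K ≤ N) :
    weight N K = ((N ! : ℝ) * N !) / ((N - K)! * (N + K + 1)!) := by
  rw [weight, cgCoeff_highest_lowest hK, Real.sq_sqrt (by positivity)]

theorem sqrt_weight {N K : ℕ} (hK : K ≤ N) :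
    √(weight N K) = cgCoeff N K (Fin.last N) 0 (midIdx K) := by
  rw [weight_eq hK, cgCoeff_highest_lowest hK]

theorem weight_pos {N K : ℕ} (hK : K ≤ N) : 0 < weight N K := by
  rw [weight_eq hK]
  positivity

theorem weight_zero (N : ℕ) : weight N 0 = 1 / ((N : ℝ) + 1) := by
  rw [weight_eq (Nat.zero_le N), Nat.sub_zero, Nat.add_zero, Nat.factorial_succ]
  push_cast
  field_simp

theorem weight_succ {N K : ℕ} (hK : K + 1 ≤ N) :
    weight N (K + 1) = ((N : ℝ) - K) / ((N : ℝ) + K + 2) * weight N K := by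
  obtain ⟨d, rfl⟩ := Nat.exists_eq_add_of_le hK
  rw [weight_eq hK, weight_eq (by omega), show K + 1 + d - (K + 1) = d by omega,
    show K + 1 + d - K = d + 1 by omega, Nat.factorial_succ d,
    show K + 1 + d + (K + 1) + 1 = (K + 1 + d + K + 1) + 1 by omega,
    Nat.factorial_succ (K + 1 + d + K + 1)]
  have h1 : (K : ℝ) + 1 + d + K + 2 ≠ 0 := by positivity
  push_cast
  field_simp
  ring

theorem weight_succ_lt {N K : ℕ} (hK : K + 1 ≤ N) : weight N (K + 1) < weight N K := by
  rw [weight_succ hK]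
  have hpos := weight_pos (N := N) (K := K) (by omega)
  refine mul_lt_of_lt_one_left hpos ?_
  rw [div_lt_one (by positivity)]
  have : (0 : ℝ) ≤ K := K.cast_nonneg
  linarith

theorem weight_lt {N K K' : ℕ} (h : K < K') (hK' : K' ≤ N) : weight N K' < weight N K := by
  induction K', h using Nat.le_induction with
  | base => exact weight_succ_lt hK'
  | succ m _ ih => exact (weight_succ_lt hK').trans (ih (by omega))

/-- The coupling to spin zero pairs opposite weights with alternating signs. -/
theorem cgCoeff_spin_zero (N : ℕ) (a b : Fin (N + 1)) :
    cgCoeff N 0 a b 0 = if b = a.rev then (-1 : ℝ) ^ (b : ℕ) * √(weight N 0) else 0 := by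
  have ha := a.is_lt
  have hb := b.is_lt
  have hval : ((a.rev : Fin (N + 1)) : ℕ) = N - a := by
    rw [Fin.val_rev]
    omega
  split_ifs with h
  · have hba : (b : ℕ) = N - a := by rw [h, hval]
    rw [cgCoeff_eq_single b (by simp; omega) (by intro s; omega), weight_zero]
    rw [show N - (b : ℕ) = a by omega, show N - (a : ℕ) = b by omega,
      show 0 + (a : ℕ) + b - N = 0 by omega, show N - 0 - (b : ℕ) = a by omega]
    simp only [Nat.sub_zero, Nat.sub_self, Nat.factorial_zero, Nat.cast_one, mul_one, zero_add,
      add_zero, Fin.val_zero, mul_zero, Nat.factorial_succ]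
    rw [show ((N ! : ℝ) / ((N + 1 : ℕ) * N ! : ℕ) * ((a : ℕ)! * (b : ℕ)!) * ((b : ℕ)! * (a : ℕ)!)) =
        ((a : ℕ)! * (b : ℕ)! : ℝ) ^ 2 * (1 / ((N : ℝ) + 1)) by push_cast; field_simp,
      Real.sqrt_mul (by positivity), Real.sqrt_sq (by positivity)]
    field_simp
  · rw [cgCoeff, if_neg]
    intro hc
    apply h
    ext
    rw [hval]
    simp at hc
    omega

/-! ### Orthogonality and completeness of the Clebsch–Gordan maps -/

theorem cg_cgBar_rep {N K K' : ℕ} (hK : K ≤ N) (hK' : K' ≤ N) (g : SU2) (x : V (2 * K')) :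
    (cg N K ∘ₗ cgBar N K') (rep (2 * K') g x) = rep (2 * K) g ((cg N K ∘ₗ cgBar N K') x) := by
  have h1 := LinearMap.congr_fun (cgBar_intertwines hK' g) x
  have h2 := LinearMap.congr_fun (cg_intertwines hK g) (cgBar N K' x)
  simp only [LinearMap.comp_apply] at h1 h2 ⊢
  rw [← h1, h2]

theorem cg_comp_cgBar_self {N K : ℕ} (hK : K ≤ N) :
    cg N K ∘ₗ cgBar N K = (2 * (K : ℂ) + 1)⁻¹ • LinearMap.id := by
  rw [schur_self (cg_cgBar_rep hK hK), LinearMap.comp_apply, ketTop, cg_cgBar_ket_apply]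
  congr 1
  have h := congrArg (fun r : ℝ => (r : ℂ)) (sum_cgCoeff_last_sq hK)
  push_cast at h
  rw [← h]
  simp only [sq]

theorem cg_comp_cgBar_ne {N K K' : ℕ} (hK : K ≤ N) (hK' : K' ≤ N) (h : K ≠ K') :
    cg N K ∘ₗ cgBar N K' = 0 :=
  schur_ne (by omega) (cg_cgBar_rep hK hK')

theorem sum_dim (N : ℕ) : ∑ K : Fin (N + 1), (2 * (K : ℕ) + 1) = (N + 1) * (N + 1) := by
  rw [← Finset.sum_range fun K => 2 * K + 1]
  induction N with
  | zero => rfl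
  | succ n ih =>
    rw [Finset.sum_range_succ, ih]
    ring

/-- Orthogonality makes the sum of the maps `cgBar N K` an injection of `⨁ K, V^K`, and by
dimension it is onto. -/
theorem exists_eq_sum_cgBar {N : ℕ} (y : V N ⊗[ℂ] V N) :
    ∃ f : ∀ K : Fin (N + 1), V (2 * (K : ℕ)), y = ∑ K : Fin (N + 1), cgBar N K (f K) := by
  let S : (∀ K : Fin (N + 1), V (2 * (K : ℕ))) →ₗ[ℂ] V N ⊗[ℂ] V N :=
    ∑ K : Fin (N + 1), cgBar N K ∘ₗ LinearMap.proj K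
  have hS : ∀ f, S f = ∑ K : Fin (N + 1), cgBar N K (f K) := fun f => by simp [S]
  have hinj : Function.Injective S := by
    rw [← LinearMap.ker_eq_bot, LinearMap.ker_eq_bot']
    intro f hf
    funext K
    have hK : (K : ℕ) ≤ N := Nat.lt_succ_iff.mp K.is_lt
    have h1 := congrArg (cg N K) hf
    rw [hS, map_sum, map_zero, Finset.sum_eq_single K, ← LinearMap.comp_apply,
      cg_comp_cgBar_self hK] at h1
    · have h2 : (2 * ((K : ℕ) : ℂ) + 1) ≠ 0 := by exact_mod_cast (2 * (K : ℕ)).succ_ne_zero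
      simpa [h2] using h1
    · intro K' _ hne
      rw [← LinearMap.comp_apply, cg_comp_cgBar_ne hK (Nat.lt_succ_iff.mp K'.is_lt)
        (fun e => hne (Fin.ext e.symm)), LinearMap.zero_apply]
    · simp
  have hdim : Module.finrank ℂ (∀ K : Fin (N + 1), V (2 * (K : ℕ))) =
      Module.finrank ℂ (V N ⊗[ℂ] V N) := by
    rw [Module.finrank_pi_fintype, Module.finrank_tensorProduct]
    simp only [finrank_euclideanSpace, Fintype.card_fin]
    exact sum_dim N
  obtain ⟨f, hf⟩ := (LinearMap.injective_iff_surjective_of_finrank_eq_finrank hdim).mp hinj y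
  exact ⟨f, by rw [← hf, hS]⟩

theorem sum_cgBar_comp_cg (N : ℕ) :
    ∑ K ∈ Finset.range (N + 1), (2 * (K : ℂ) + 1) • (cgBar N K ∘ₗ cg N K) = LinearMap.id := by
  refine LinearMap.ext fun y => ?_
  obtain ⟨f, rfl⟩ := exists_eq_sum_cgBar y
  rw [Finset.sum_range, LinearMap.sum_apply, LinearMap.id_apply]
  refine Finset.sum_congr rfl fun K _ => ?_
  have hK : (K : ℕ) ≤ N := Nat.lt_succ_iff.mp K.is_lt
  rw [LinearMap.smul_apply, LinearMap.comp_apply, map_sum, Finset.sum_eq_single K,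
    ← LinearMap.comp_apply (cg N K), cg_comp_cgBar_self hK]
  · have h2 : (2 * ((K : ℕ) : ℂ) + 1) ≠ 0 := by exact_mod_cast (2 * (K : ℕ)).succ_ne_zero
    rw [LinearMap.smul_apply, map_smul, smul_smul, mul_inv_cancel₀ h2, one_smul,
      LinearMap.id_apply]
  · intro K' _ hne
    rw [← LinearMap.comp_apply, cg_comp_cgBar_ne hK (Nat.lt_succ_iff.mp K'.is_lt)
      (fun e => hne (Fin.ext e.symm)), LinearMap.zero_apply]
  · simp

theorem inner_cgBar_left {N K : ℕ} (x : V (2 * K)) (y : V N ⊗[ℂ] V N) :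
    inner ℂ (cgBar N K x) y = inner ℂ x (cg N K y) := by
  rw [cgBar_eq_adjoint, LinearMap.adjoint_inner_left]

/-! ### Coherent states -/

theorem gravState_eq_map (N : ℕ) (n : SU2) :
    gravState N n = TensorProduct.map (rep N n) (rep N n) (ketTop N ⊗ₜ ketBot N) := rfl

theorem cg_ketTop_tmul_ketBot {N K : ℕ} (hK : K ≤ N) :
    cg N K (ketTop N ⊗ₜ ketBot N) = (√(weight N K) : ℂ) • ketZero K := by
  rw [ketTop, ketBot, cg_ket_tmul_ket, Finset.sum_eq_single (midIdx K), sqrt_weight hK, ketZero]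
  · intro c _ hc
    rw [cgCoeff, if_neg, Complex.ofReal_zero, zero_smul]
    intro h
    apply hc
    ext
    rw [Fin.val_last, Fin.val_zero] at h
    change (c : ℕ) = K
    omega
  · simp

/-- The resolution of the identity is applied to the state at `n = 1`; the coefficient
`√(weight N K)` carries no sign because the Clebsch–Gordan coefficient it equals is positive. -/
theorem gravState_eq_sum (N : ℕ) (n : SU2) :
    gravState N n = ∑ K ∈ Finset.range (N + 1),
      ((2 * (K : ℂ) + 1) * (√(weight N K) : ℂ)) • cgBar N K (rep (2 * K) n (ketZero K)) := by
  rw [gravState_eq_map]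
  conv_lhs => rw [← LinearMap.id_apply (R := ℂ) (ketTop N ⊗ₜ[ℂ] ketBot N), ← sum_cgBar_comp_cg N]
  rw [LinearMap.sum_apply, map_sum]
  refine Finset.sum_congr rfl fun K hK => ?_
  have hK' : K ≤ N := Nat.lt_succ_iff.mp (Finset.mem_range.mp hK)
  rw [LinearMap.smul_apply, LinearMap.comp_apply, cg_ketTop_tmul_ketBot hK', map_smul, map_smul,
    map_smul, smul_smul, ← LinearMap.comp_apply, cgBar_intertwines hK', LinearMap.comp_apply]

theorem coherent_mul_eps (N : ℕ) (n : SU2) :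
    coherent N (n * eps) = (-1 : ℂ) ^ N • conjCoherent N n := by
  rw [coherent, map_mul, Module.End.mul_apply, ketTop, rep_eps_ket, map_smul, Fin.val_last,
    Fin.rev_last, conjCoherent, ketBot]

theorem gravState_mul_of_isDiag (N : ℕ) (n h : SU2)
    (hh : (h : Matrix (Fin 2) (Fin 2) ℂ).IsDiag) : gravState N (n * h) = gravState N n := by
  have h01 : h.1 0 1 = 0 := hh (by decide)
  have hdet : h.1 0 0 * h.1 1 1 = 1 := by
    have := (Matrix.mem_specialUnitaryGroup_iff.mp h.2).2
    rwa [Matrix.det_fin_two, h01, zero_mul, sub_zero] at this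
  simp only [gravState, coherent, conjCoherent, map_mul, Module.End.mul_apply, ketTop, ketBot,
    rep_ket_of_isDiag N h hh, map_smul, TensorProduct.smul_tmul_smul]
  simp [← mul_pow, hdet]

theorem continuous_gravState (N : ℕ) : Continuous (gravState N) :=
  TensorProduct.continuous_tmul.comp
    ((continuous_rep N (ketTop N)).prodMk (continuous_rep N (ketBot N)))

theorem integrable_ketBra_gravState (N : ℕ) (x : V N ⊗[ℂ] V N) :
    Integrable (fun n => ketBra N (gravState N n) x) haarSU2 :=
  integrable_haarSU2_of_continuous
    (((continuous_gravState N).inner continuous_const).fun_smul (continuous_gravState N))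

theorem coherent_tmul_coherent_mul_eps (N : ℕ) (n : SU2) :
    coherent N n ⊗ₜ[ℂ] coherent N (n * eps) = (-1 : ℂ) ^ N • gravState N n := by
  rw [coherent_mul_eps, TensorProduct.tmul_smul, gravState]

/-! ### The gravitational intertwiner -/

theorem inner_gravState (N : ℕ) (n : SU2) (x : V N ⊗[ℂ] V N) :
    inner ℂ (gravState N n) x = ∑ K ∈ Finset.range (N + 1),
      ((2 * (K : ℂ) + 1) * (√(weight N K) : ℂ)) *
        inner ℂ (rep (2 * K) n (ketZero K)) (cg N K x) := by
  rw [gravState_eq_sum, sum_inner]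
  refine Finset.sum_congr rfl fun K _ => ?_
  rw [← map_smul, inner_cgBar_left, inner_smul_left]
  simp only [map_mul, map_add, map_one, map_ofNat, map_natCast, Complex.conj_ofReal]

theorem ketBra_gravState (N : ℕ) (n : SU2) (x : V N ⊗[ℂ] V N) :
    ketBra N (gravState N n) x = ∑ K ∈ Finset.range (N + 1), ∑ K' ∈ Finset.range (N + 1),
      (((2 * (K : ℂ) + 1) * (√(weight N K) : ℂ)) * ((2 * (K' : ℂ) + 1) * (√(weight N K') : ℂ))) •
        cgBar N K (inner ℂ (rep (2 * K') n (ketZero K')) (cg N K' x) •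
          rep (2 * K) n (ketZero K)) := by
  rw [ketBra, inner_gravState, Finset.sum_smul, Finset.sum_comm]
  refine Finset.sum_congr rfl fun K' _ => ?_
  rw [gravState_eq_sum, Finset.smul_sum]
  refine Finset.sum_congr rfl fun K _ => ?_
  rw [map_smul, smul_smul, smul_smul]
  congr 1
  ring

theorem inner_ketZero_self (K : ℕ) : inner ℂ (ketZero K) (ketZero K) = (1 : ℂ) := by
  rw [ketZero, inner_ket, ket_apply, if_pos rfl]

theorem integral_ketBra_gravState (N : ℕ) (x : V N ⊗[ℂ] V N) :
    ∫ n, ketBra N (gravState N n) x ∂haarSU2 = ∑ K ∈ Finset.range (N + 1),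
      ((2 * (K : ℂ) + 1) * (weight N K : ℂ)) • cgBar N K (cg N K x) := by
  have : CompleteSpace (V N ⊗[ℂ] V N) := FiniteDimensional.complete ℂ _
  have hcont : ∀ K K' : ℕ, Continuous fun n : SU2 =>
      inner ℂ (rep (2 * K') n (ketZero K')) (cg N K' x) • rep (2 * K) n (ketZero K) :=
    fun K K' => continuous_inner_smul_rep _ _ _
  have hint : ∀ (K K' : ℕ) (z : ℂ), Integrable (fun n : SU2 => z • cgBar N K
      (inner ℂ (rep (2 * K') n (ketZero K')) (cg N K' x) • rep (2 * K) n (ketZero K))) haarSU2 :=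
    fun K K' z => integrable_haarSU2_of_continuous
      (((LinearMap.toContinuousLinearMap (cgBar N K)).continuous.comp
        (hcont K K')).fun_const_smul z)
  have hterm : ∀ K K' : ℕ, ∫ n, cgBar N K
      (inner ℂ (rep (2 * K') n (ketZero K')) (cg N K' x) • rep (2 * K) n (ketZero K)) ∂haarSU2 =
        cgBar N K (haarAverage (ketZero K') (ketZero K) (cg N K' x)) := fun K K' =>
    (LinearMap.toContinuousLinearMap (cgBar N K)).integral_comp_comm
      (integrable_haarSU2_of_continuous (hcont K K'))
  simp only [ketBra_gravState]
  rw [integral_finsetSum _ fun K _ => integrable_finsetSum _ fun K' _ => hint K K' _]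
  refine Finset.sum_congr rfl fun K hK => ?_
  rw [integral_finsetSum _ fun K' _ => hint K K' _, Finset.sum_eq_single_of_mem K hK]
  · have hK' : K ≤ N := Nat.lt_succ_iff.mp (Finset.mem_range.mp hK)
    have hw : (√(weight N K) : ℂ) * (√(weight N K) : ℂ) = (weight N K : ℂ) := by
      rw [← Complex.ofReal_mul, Real.mul_self_sqrt (weight_pos hK').le]
    have h2 : 2 * (K : ℂ) + 1 ≠ 0 := by exact_mod_cast (2 * K).succ_ne_zero
    rw [integral_smul, hterm, haarAverage_self, inner_ketZero_self, LinearMap.smul_apply, map_smul,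
      smul_smul, LinearMap.id_apply, ← hw]
    congr 1
    push_cast
    field_simp
  · intro K' _ hne
    rw [integral_smul, hterm, haarAverage_eq_zero (by omega), LinearMap.zero_apply, map_zero,
      smul_zero]

/-! ### The Barrett–Crane intertwiner -/

theorem rep_spin_zero (g : SU2) (x : V 0) : rep 0 g x = x := by
  have h : rep 0 g = LinearMap.id := by
    refine linearMap_ext_spinorState fun t => ?_
    rw [rep_spinorState, LinearMap.id_apply]
    ext a
    simp [spinorState]
  rw [h, LinearMap.id_apply]

theorem sqrt_weight_zero_mul_self (N : ℕ) :
    (√(weight N 0) : ℂ) * (√(weight N 0) : ℂ) = (weight N 0 : ℂ) := by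
  rw [← Complex.ofReal_mul, Real.mul_self_sqrt (weight_pos N.zero_le).le]

theorem barrettCrane_eq (N : ℕ) :
    barrettCrane N = ((-1 : ℂ) ^ N * (√(weight N 0) : ℂ)) • cgBar N 0 (ketZero 0) := by
  have hw : ((N : ℂ) + 1)⁻¹ = (√(weight N 0) : ℂ) * (√(weight N 0) : ℂ) := by
    rw [sqrt_weight_zero_mul_self, weight_zero]
    push_cast
    rw [one_div]
  have hz : ketZero 0 = ket (2 * 0) 0 := rfl
  rw [barrettCrane, hz, cgBar_ket, Finset.smul_sum, Finset.smul_sum]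
  refine Finset.sum_congr rfl fun a _ => ?_
  rw [Finset.sum_eq_single a.rev, cgCoeff_spin_zero, if_pos rfl, rep_eps_ket,
    TensorProduct.tmul_smul, smul_smul, smul_smul, hw]
  · congr 1
    have hrev : ((a.rev : Fin (N + 1)) : ℕ) = N - a := by
      rw [Fin.val_rev]
      omega
    have hsign : (-1 : ℂ) ^ N * (-1) ^ (N - (a : ℕ)) = (-1) ^ (a : ℕ) := by
      have hN : (-1 : ℂ) ^ N = (-1) ^ (a : ℕ) * (-1) ^ (N - (a : ℕ)) := by
        rw [← pow_add]
        congr 1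
        omega
      rw [hN, mul_assoc, ← mul_pow, neg_one_mul, neg_neg, one_pow, mul_one]
    rw [hrev, ← hsign]
    push_cast
    ring
  · intro b _ hb
    rw [cgCoeff_spin_zero, if_neg hb, Complex.ofReal_zero, zero_smul]
  · simp

theorem map_rep_barrettCrane (N : ℕ) (g : SU2) :
    TensorProduct.map (rep N g) (rep N g) (barrettCrane N) = barrettCrane N := by
  rw [barrettCrane_eq, map_smul, ← LinearMap.comp_apply, cgBar_intertwines N.zero_le,
    LinearMap.comp_apply]
  congr 2
  exact rep_spin_zero g _

/-- Orthogonality to the constant matrix element of the trivial representation. -/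
theorem integral_rep_eq_zero {N : ℕ} (hN : N ≠ 0) (y : V N) :
    ∫ n, rep N n y ∂haarSU2 = 0 := by
  have h := LinearMap.congr_fun (haarAverage_eq_zero hN.symm (ket 0 0) y) (ket 0 0)
  rw [haarAverage_apply, LinearMap.zero_apply] at h
  simpa only [rep_spin_zero, inner_ket, ket_apply, if_true, one_smul] using h

theorem integral_coherent_tmul_coherent_mul_eps (N : ℕ) :
    ∫ n, coherent N n ⊗ₜ[ℂ] coherent N (n * eps) ∂haarSU2 = barrettCrane N := by
  have : CompleteSpace (V N ⊗[ℂ] V N) := FiniteDimensional.complete ℂ _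
  have hcont := fun K : ℕ => continuous_rep (2 * K) (ketZero K)
  have hint : ∀ (K : ℕ) (z : ℂ), Integrable
      (fun n : SU2 => z • cgBar N K (rep (2 * K) n (ketZero K))) haarSU2 :=
    fun K z => integrable_haarSU2_of_continuous
      (((LinearMap.toContinuousLinearMap (cgBar N K)).continuous.comp (hcont K)).fun_const_smul z)
  have hterm : ∀ K : ℕ, ∫ n, cgBar N K (rep (2 * K) n (ketZero K)) ∂haarSU2 =
      cgBar N K (∫ n, rep (2 * K) n (ketZero K) ∂haarSU2) := fun K =>
    (LinearMap.toContinuousLinearMap (cgBar N K)).integral_comp_comm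
      (integrable_haarSU2_of_continuous (hcont K))
  simp only [coherent_tmul_coherent_mul_eps, gravState_eq_sum]
  rw [integral_smul, integral_finsetSum _ fun K _ => hint K _,
    Finset.sum_eq_single_of_mem 0 (Finset.mem_range.mpr N.succ_pos)]
  · have h0 : ∫ n, rep (2 * 0) n (ketZero 0) ∂haarSU2 = ketZero 0 := by
      have : ∀ n : SU2, rep (2 * 0) n (ketZero 0) = ketZero 0 := fun n => rep_spin_zero n _
      simp only [this, integral_const, probReal_univ, one_smul]
    rw [integral_smul, hterm, h0, smul_smul, barrettCrane_eq]
    simp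
  · intro K _ hK
    rw [integral_smul, hterm, integral_rep_eq_zero (by omega), map_zero, smul_zero]

theorem cgBar_cg_zero (N : ℕ) (x : V N ⊗[ℂ] V N) :
    (weight N 0 : ℂ) • cgBar N 0 (cg N 0 x) = ketBra N (barrettCrane N) x := by
  have hx : cg N 0 x = inner ℂ (ketZero 0) (cg N 0 x) • ketZero 0 := by
    ext c
    have hc : c = midIdx 0 := Subsingleton.elim (α := Fin 1) _ _
    rw [ketZero, inner_ket, PiLp.smul_apply, ket_apply, if_pos hc, hc, smul_eq_mul, mul_one]
  have hinner : inner ℂ (barrettCrane N) x =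
      ((-1 : ℂ) ^ N * (√(weight N 0) : ℂ)) * inner ℂ (ketZero 0) (cg N 0 x) := by
    rw [barrettCrane_eq, ← map_smul, inner_cgBar_left, inner_smul_left]
    simp
  rw [ketBra, hinner, hx, map_smul, barrettCrane_eq, smul_smul, smul_smul, ← hx,
    ← sqrt_weight_zero_mul_self]
  congr 1
  have hsign : (-1 : ℂ) ^ N * (-1) ^ N = 1 := by
    rw [← mul_pow, neg_one_mul, neg_neg, one_pow]
  linear_combination (-(√(weight N 0) : ℂ) * √(weight N 0) *
    inner ℂ (ketZero 0) (cg N 0 x)) * hsign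

end

end SpinFoam

theorem mainTheorem6 (N : ℕ) :
    -- the maps `C^{jjk}` and their conjugates are `SU(2)`-intertwiners, adjoint to each other
    (∀ K ≤ N, ∀ g : SU2,
      cg N K ∘ₗ TensorProduct.map (rep N g) (rep N g) = rep (2 * K) g ∘ₗ cg N K) ∧
    (∀ K ≤ N, ∀ g : SU2,
      TensorProduct.map (rep N g) (rep N g) ∘ₗ cgBar N K = cgBar N K ∘ₗ rep (2 * K) g) ∧
    (∀ K ≤ N, ∀ (x : V (2 * K)) (y : V N ⊗[ℂ] V N),
      inner ℂ (cgBar N K x) y = inner ℂ x (cg N K y)) ∧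
    -- with the normalization `C^{jjk} ∘ conj C^{jjk'} = δ_{kk'} / d_k` and the resolution of 1
    (∀ K ≤ N, cg N K ∘ₗ cgBar N K = (2 * (K : ℂ) + 1)⁻¹ • LinearMap.id) ∧
    (∀ K ≤ N, ∀ K' ≤ N, K ≠ K' → cg N K ∘ₗ cgBar N K' = 0) ∧
    (∑ K ∈ Finset.range (N + 1), (2 * (K : ℂ) + 1) • (cgBar N K ∘ₗ cg N K) = LinearMap.id) ∧
    -- the decomposition of `|j, n⟩ ⊗ conj |j, n⟩`
    (∀ n : SU2, gravState N n = ∑ K ∈ Finset.range (N + 1),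
      ((2 * (K : ℂ) + 1) * (√(weight N K) : ℂ)) • cgBar N K (rep (2 * K) n (ketZero K))) ∧
    -- the two descriptions of the conjugate state agree up to the sign `(-1)^{2j}`
    (∀ n : SU2, coherent N (n * eps) = (-1 : ℂ) ^ N • conjCoherent N n) ∧
    -- the value of the weights
    (∀ K ≤ N, weight N K = ((N ! : ℝ) * N !) / ((N - K)! * (N + K + 1)!)) ∧
    -- the integrand of `G_j` is integrable and depends only on the coset of `n` modulo `U(1)`
    (∀ x, Integrable (fun n => ketBra N (gravState N n) x) haarSU2) ∧
    (∀ n h : SU2, (h : Matrix (Fin 2) (Fin 2) ℂ).IsDiag → gravState N (n * h) = gravState N n) ∧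
    -- the formula for `G_j`
    (∀ x, gravIntertwiner N x = ((N : ℂ) + 1) ^ 2 • ∑ K ∈ Finset.range (N + 1),
      ((2 * (K : ℂ) + 1) * (weight N K : ℂ)) • cgBar N K (cg N K x)) ∧
    -- the term `k = 0` is the product of the Barrett-Crane intertwiner with its conjugate
    (∀ g : SU2, TensorProduct.map (rep N g) (rep N g) (barrettCrane N) = barrettCrane N) ∧
    Integrable (fun n => coherent N n ⊗ₜ[ℂ] coherent N (n * eps)) haarSU2 ∧
    (∫ n, coherent N n ⊗ₜ[ℂ] coherent N (n * eps) ∂haarSU2 = barrettCrane N) ∧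
    (∀ x, ((N : ℂ) + 1) ^ 2 • ((2 * ((0 : ℕ) : ℂ) + 1) * (weight N 0 : ℂ)) •
        cgBar N 0 (cg N 0 x) = ((N : ℂ) + 1) ^ 2 • ketBra N (barrettCrane N) x) ∧
    -- the weights decrease with `k`
    weight N 0 = 1 / ((N : ℝ) + 1) ∧
    (∀ K, 1 ≤ K → K ≤ N →
      weight N K = ((N : ℝ) + 1 - K) / ((N : ℝ) + 1 + K) * weight N (K - 1)) ∧
    (∀ K K', K < K' → K' ≤ N → weight N K' < weight N K) := by 
  refine ⟨fun K hK g => cg_intertwines hK g, fun K hK g => cgBar_intertwines hK g,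
    fun K _ x y => inner_cgBar_left x y, fun K hK => cg_comp_cgBar_self hK,
    fun K hK K' hK' h => cg_comp_cgBar_ne hK hK' h, sum_cgBar_comp_cg N, gravState_eq_sum N,
    coherent_mul_eps N, fun K hK => weight_eq hK, integrable_ketBra_gravState N,
    gravState_mul_of_isDiag N, fun x => ?_, map_rep_barrettCrane N, ?_,
    integral_coherent_tmul_coherent_mul_eps N, fun x => ?_, weight_zero N, ?_,
    fun K K' h hK' => weight_lt h hK'⟩
  · rw [gravIntertwiner, integral_ketBra_gravState]
  · simp only [coherent_tmul_coherent_mul_eps]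
    exact integrable_haarSU2_of_continuous ((continuous_gravState N).fun_const_smul _)
  · rw [← cgBar_cg_zero, Nat.cast_zero, mul_zero, zero_add, one_mul]
  · intro K h1 hK
    obtain ⟨k, rfl⟩ := Nat.exists_eq_add_of_le' h1
    rw [weight_succ hK, Nat.add_sub_cancel]
    push_cast
    congr 2 <;> ring
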